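/- Let $m,n,d\in\mathbb N$ and let $R_{m,n}=\mathbb C[z_{ij}]_{1\le i\le m,\,1\le j\le n}$, with monomials $z^\alpha=\prod_{i,j}z_{ij}^{\alpha_{ij}}$ for $\alpha\in\mathrm{Mat}_{m,n}(\mathbb N)$. For $\alpha\in\mathrm{Mat}_{m,n}(\mathbb N)$, let $(P,Q)=\mathrm{RSK}(\alpha)$ be the pair of semistandard tableaux of the same shape obtained as follows: read the entries of $\alpha$ down the columns, from left to right, recording the biletter $(i|j)$ with multiplicity $\alpha_{ij}$; then, starting from $(\emptyset,\emptyset)$, insert these biletters successively, where inserting $(i|j)$ means row-inserting $i$ into $P$ and placing $j$ in $Q$ in the position of the newly created box. Let $[P|Q]\in R_{m,n}$ be the associated bitableau, i.e. the product over $c$ of the minors of the generic matrix $(z_{ij})$ whose row indices are the entries of the $c$-th column of $P$ and whose column indices are the entries of the $c$-th column of $Q$. Let $\mathsf{RSK}:R_{m,n}\to R_{m,n}$ be the $\mathbb C$-linear operator with $\mathsf{RSK}(z^\alpha)=[P|Q]$, where $(P,Q)=\mathrm{RSK}(\alpha)$. This operator preserves the span $R_{m,n,d}$ of the monomials of degree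 $d$ and, for all $\sigma\in\mathbb N^m$ and $\pi\in\mathbb N^n$ with $\sum_i\sigma_i=\sum_j\pi_j$, the span $R_{\sigma,\pi}$ of the monomials $z^\alpha$ such that $\alpha$ has row sums $\sigma$ and column sums $\pi$. Let $\mathsf{RSK}_{m,n,d}$ and $\mathsf{RSK}_{\sigma,\pi}$ denote its restrictions to these spaces, viewed as matrices in the monomial bases. Then $$\det \mathsf{RSK}_{m,n,d}\in\{1,-1\}\qquad\text{and}\qquad \det \mathsf{RSK}_{\sigma,\pi}\in\{1,-1\}.$$ -/

import Mathlib

namespace RSKOperator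

/-! ### The combinatorial RSK correspondence

Labels are taken in `Fin m` (for `P`) and `Fin n` (for `Q`), that is, they start at `0`.
A tableau is the list of its rows, from top to bottom. -/

/-- A filling given by the list of its rows, from top to bottom. -/
abbrev Tableau (A : Type) : Type := List (List A)

/-- Insertion of `p` into one (weakly increasing) row. If some label exceeds `p`, the leftmost
such label (hence the smallest label exceeding `p`) is replaced by `p` and returned as the bumped
label; otherwise `p` is put at the end of the row and nothing is bumped. -/
def rowInsert {A : Type} [LinearOrder A] (p : A) : List A → List A × Option A
  | [] => ([p], none)
  | x :: xs =>
    if p < x then (p :: xs, some x)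
    else (x :: (rowInsert p xs).1, (rowInsert p xs).2)

/-- Insertion `(P, Q) ← (p | q)` of a biletter into a pair of tableaux of common shape, given as
the list of pairs (`i`-th row of `P`, `i`-th row of `Q`): `p` is inserted into the first row of
`P`, the bumped label into the second row, and so on; the row of `P` that finally grows by a box
has the label `q` put at the end of the same row of `Q`. -/
def insertBiletter {A B : Type} [LinearOrder A] (p : A) (q : B) :
    List (List A × List B) → List (List A × List B)
  | [] => [([p], [q])]
  | (r, s) :: rest =>
    match rowInsert p r with
    | (r', none) => (r', s ++ [q]) :: rest
    | (r', some p') => (r', s) :: insertBiletter p' q rest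

/-- The biword of an exponent matrix: read the entries down the columns, from the left column to
the right one, and record the biletter `(i | j)` with multiplicity `α i j`. -/
def biword {m n : ℕ} (α : Matrix (Fin m) (Fin n) ℕ) : List (Fin m × Fin n) :=
  (List.finRange n).flatMap fun j =>
    (List.finRange m).flatMap fun i => List.replicate (α i j) (i, j)

/-- Successive insertion of a list of biletters, first letter first, starting from the empty
pair; the result is the list of pairs of rows of `P` and `Q`. -/
def insertWord {A B : Type} [LinearOrder A] (w : List (A × B)) : List (List A × List B) :=
  w.foldl (fun T x => insertBiletter x.1 x.2 T) []

/-- The pair of tableaux `RSK(α) = (P, Q)`. -/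
def rsk {m n : ℕ} (α : Matrix (Fin m) (Fin n) ℕ) : Tableau (Fin m) × Tableau (Fin n) :=
  ((insertWord (biword α)).map Prod.fst, (insertWord (biword α)).map Prod.snd)

/-! ### Bitableaux -/

/-- The coordinate ring `ℂ[z_{ij}]` of the space of `m × n` complex matrices. -/
abbrev CoordRing (m n : ℕ) : Type := MvPolynomial (Fin m × Fin n) ℂ

/-- The entries of the `c`-th column of a tableau (columns are numbered from `0`),
from top to bottom. -/
def column {A : Type} (c : ℕ) (T : Tableau A) : List A := T.filterMap fun r => r[c]?

/-- The number of columns of a tableau: the largest length of a row. -/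
def numColumns {A : Type} (T : Tableau A) : ℕ := (T.map List.length).foldr max 0

/-- The minor `det (z_{I_a, J_b})_{a, b}` of the generic `m × n` matrix with the lists of row
indices `I` and of column indices `J`; these lists have the same length in every bitableau
(and the value is set to `0` if they have not). -/
noncomputable def minor {m n : ℕ} (I : List (Fin m)) (J : List (Fin n)) : CoordRing m n :=
  if h : I.length = J.length then
    Matrix.det (Matrix.of fun a b : Fin I.length =>
      (MvPolynomial.X (I.get a, J.get (Fin.cast h b)) : CoordRing m n))
  else 0

/-- The bitableau `[P|Q]`: the product over `c` of the minors whose row and column indices are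
the entries of the `c`-th columns of `P` and of `Q`. -/
noncomputable def bitableau {m n : ℕ} (P : Tableau (Fin m)) (Q : Tableau (Fin n)) : CoordRing m n :=
  ∏ c ∈ Finset.range (max (numColumns P) (numColumns Q)), minor (column c P) (column c Q)

/-! ### The linear operator -/

/-- An exponent matrix as a finitely supported function on the set of variables. -/
noncomputable def exponent {m n : ℕ} (α : Matrix (Fin m) (Fin n) ℕ) : Fin m × Fin n →₀ ℕ :=
  Finsupp.equivFunOnFinite.symm fun x => α x.1 x.2

/-- The monomial `z^α = ∏ z_{ij} ^ α_{ij}`. -/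
noncomputable def zMonomial {m n : ℕ} (α : Matrix (Fin m) (Fin n) ℕ) : CoordRing m n :=
  MvPolynomial.monomial (exponent α) 1

/-- The linear operator on `ℂ[z_{ij}]` that sends each monomial `z^α` to the bitableau `[P|Q]`,
where `(P, Q) = RSK(α)`. -/
noncomputable def operator (m n : ℕ) : CoordRing m n →ₗ[ℂ] CoordRing m n :=
  (MvPolynomial.basisMonomials (Fin m × Fin n) ℂ).constr ℂ fun e =>
    bitableau (rsk (Matrix.of fun i j => e (i, j))).1 (rsk (Matrix.of fun i j => e (i, j))).2

/-- The exponent matrices of the monomials of degree `d`. -/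
abbrev DegreeTable (m n d : ℕ) : Type :=
  {α : Matrix (Fin m) (Fin n) ℕ // ∑ i, ∑ j, α i j = d}

/-- The contingency tables with row margins `σ` and column margins `π`. -/
abbrev Cont {m n : ℕ} (σ : Fin m → ℕ) (π : Fin n → ℕ) : Type :=
  {α : Matrix (Fin m) (Fin n) ℕ // (∀ i, ∑ j, α i j = σ i) ∧ (∀ j, ∑ i, α i j = π j)}

/-- The space `R_{m,n,d}` spanned by the monomials of degree `d`. -/
noncomputable def degreeSpace (m n d : ℕ) : Submodule ℂ (CoordRing m n) :=
  Submodule.span ℂ (Set.range fun α : DegreeTable m n d => zMonomial α.1)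

/-- The weight space `R_{σ,π}` spanned by the monomials `z^α` with `α ∈ Cont_{σ,π}`. -/
noncomputable def weightSpace {m n : ℕ} (σ : Fin m → ℕ) (π : Fin n → ℕ) :
    Submodule ℂ (CoordRing m n) :=
  Submodule.span ℂ (Set.range fun α : Cont σ π => zMonomial α.1)

/-! ### The operator preserves degrees and weights -/

theorem rowInsert_content {A : Type} [LinearOrder A] (p : A) (r : List A) :
    ((rowInsert p r).1 : Multiset A) + ((rowInsert p r).2.toList : Multiset A) = p ::ₘ r := by
  induction r with
  | nil => simp [rowInsert]
  | cons x xs ih =>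
    unfold rowInsert
    split_ifs with h
    · simp only [Option.toList_some, ← Multiset.cons_coe, Multiset.cons_add, Multiset.coe_nil]
      rw [add_comm, Multiset.cons_add, zero_add]
    · simp only [← Multiset.cons_coe, Multiset.cons_add]
      rw [ih, Multiset.cons_swap]

theorem insertBiletter_content {A B : Type} [LinearOrder A] (p : A) (q : B)
    (T : List (List A × List B)) :
    (((insertBiletter p q T).map Prod.fst).flatten : Multiset A)
        = p ::ₘ ((T.map Prod.fst).flatten : Multiset A) ∧
      (((insertBiletter p q T).map Prod.snd).flatten : Multiset B)
        = q ::ₘ ((T.map Prod.snd).flatten : Multiset B) := by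
  induction T generalizing p with
  | nil => simp [insertBiletter]
  | cons rs rest ih =>
    obtain ⟨r, s⟩ := rs
    have hc := rowInsert_content p r
    unfold insertBiletter
    rcases hr : rowInsert p r with ⟨r', _ | p'⟩
    · rw [hr] at hc
      simp only [Option.toList_none, Multiset.coe_nil, add_zero] at hc
      constructor
      · simp only [List.map_cons, List.flatten_cons, ← Multiset.coe_add]
        rw [hc, Multiset.cons_add]
      · simp only [List.map_cons, List.flatten_cons, ← Multiset.coe_add, Multiset.coe_singleton]
        rw [add_comm (s : Multiset B), Multiset.singleton_add, Multiset.cons_add]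
    · rw [hr] at hc
      simp only [Option.toList_some, Multiset.coe_singleton] at hc
      obtain ⟨h1, h2⟩ := ih p'
      constructor
      · simp only [List.map_cons, List.flatten_cons, ← Multiset.coe_add]
        rw [h1, ← Multiset.singleton_add, ← add_assoc, hc, Multiset.cons_add]
      · simp only [List.map_cons, List.flatten_cons, ← Multiset.coe_add]
        rw [h2, Multiset.add_cons]

theorem foldl_insertBiletter_content {A B : Type} [LinearOrder A] (w : List (A × B))
    (T : List (List A × List B)) :
    (((w.foldl (fun T x => insertBiletter x.1 x.2 T) T).map Prod.fst).flatten : Multiset A)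
        = ((T.map Prod.fst).flatten : Multiset A) + (w.map Prod.fst : Multiset A) ∧
      (((w.foldl (fun T x => insertBiletter x.1 x.2 T) T).map Prod.snd).flatten : Multiset B)
        = ((T.map Prod.snd).flatten : Multiset B) + (w.map Prod.snd : Multiset B) := by
  induction w generalizing T with
  | nil => simp
  | cons x w ih =>
    obtain ⟨h1, h2⟩ := ih (insertBiletter x.1 x.2 T)
    obtain ⟨g1, g2⟩ := insertBiletter_content x.1 x.2 T
    simp only [List.foldl_cons, List.map_cons, ← Multiset.cons_coe, Multiset.add_cons]
    rw [h1, h2, g1, g2, Multiset.cons_add, Multiset.cons_add]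
    exact ⟨rfl, rfl⟩

/-- The weight of a variable: its row index and its column index. -/
def varWeight {m n : ℕ} (x : Fin m × Fin n) : Multiset (Fin m) × Multiset (Fin n) :=
  ({x.1}, {x.2})

theorem biword_coe {m n : ℕ} (α : Matrix (Fin m) (Fin n) ℕ) :
    (biword α : Multiset (Fin m × Fin n)) = ∑ j, ∑ i, α i j • {(i, j)} := by
  have key : ∀ {A B : Type} (l : List A) (f : A → List B),
      (l.flatMap f : Multiset B) = (l.map fun a => (f a : Multiset B)).sum := by
    intro A B l f
    induction l with
    | nil => simp
    | cons a l ih => simp [List.flatMap_cons, ← Multiset.coe_add, ih]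
  unfold biword
  rw [key, ← List.sum_ofFn, List.ofFn_eq_map]
  congr 2
  funext j
  rw [key, ← List.sum_ofFn, List.ofFn_eq_map]
  congr 2
  funext i
  rw [Multiset.nsmul_singleton, Multiset.coe_replicate]

theorem weight_exponent {m n : ℕ} (α : Matrix (Fin m) (Fin n) ℕ) :
    Finsupp.weight varWeight (exponent α)
      = (∑ i, ∑ j, α i j • {i}, ∑ j, ∑ i, α i j • {j}) := by
  rw [Finsupp.weight_apply, Finsupp.sum_fintype _ _ (by simp), Fintype.sum_prod_type]
  simp only [exponent, Finsupp.equivFunOnFinite_symm_apply_apply, varWeight]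
  ext1
  · simp [Prod.fst_sum]
  · simp only [Prod.snd_sum, Prod.smul_snd]
    exact Finset.sum_comm

theorem rsk_content {m n : ℕ} (α : Matrix (Fin m) (Fin n) ℕ) :
    ((((rsk α).1.flatten : List (Fin m)) : Multiset (Fin m)),
      (((rsk α).2.flatten : List (Fin n)) : Multiset (Fin n)))
      = Finsupp.weight varWeight (exponent α) := by
  obtain ⟨h1, h2⟩ := foldl_insertBiletter_content (biword α) []
  have e1 : ((biword α).map Prod.fst : Multiset (Fin m)) = ∑ i, ∑ j, α i j • {i} := by
    rw [← Multiset.map_coe, biword_coe, ← Multiset.coe_mapAddMonoidHom, Finset.sum_comm]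
    simp [map_sum, Multiset.map_nsmul]
  have e2 : ((biword α).map Prod.snd : Multiset (Fin n)) = ∑ j, ∑ i, α i j • {j} := by
    rw [← Multiset.map_coe, biword_coe, ← Multiset.coe_mapAddMonoidHom]
    simp [map_sum, Multiset.map_nsmul]
  rw [weight_exponent, ← e1, ← e2]
  simp only [List.map_nil, List.flatten_nil, Multiset.coe_nil, zero_add] at h1 h2
  exact Prod.ext h1 h2

theorem sum_column {A : Type} (T : Tableau A) (N : ℕ) (hN : numColumns T ≤ N) :
    ∑ c ∈ Finset.range N, (column c T : Multiset A) = (T.flatten : Multiset A) := by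
  have row : ∀ (r : List A) (N : ℕ), r.length ≤ N →
      ∑ c ∈ Finset.range N, (r[c]?.toList : Multiset A) = (r : Multiset A) := by
    intro r
    induction r with
    | nil => intro N _; simp
    | cons x xs ih =>
      intro N h
      obtain ⟨k, rfl⟩ : ∃ k, N = k + 1 := ⟨N - 1, by simp at h; omega⟩
      rw [Finset.sum_range_succ']
      simp only [List.getElem?_cons_succ, List.getElem?_cons_zero]
      rw [ih k (by simpa using h)]
      simp only [Option.toList_some, ← Multiset.cons_coe, Multiset.coe_nil]
      rw [add_comm, Multiset.cons_add, zero_add]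
  induction T with
  | nil => simp [column]
  | cons r T ih =>
    have h : max r.length (numColumns T) ≤ N := hN
    rw [max_le_iff] at h
    have hcol : ∀ c, (column c (r :: T) : Multiset A)
        = (r[c]?.toList : Multiset A) + (column c T : Multiset A) := by
      intro c
      unfold column
      rw [List.filterMap_cons]
      cases r[c]? <;> simp [← Multiset.cons_coe]
    simp only [hcol, Finset.sum_add_distrib]
    rw [row r N h.1, ih h.2]
    simp

theorem sum_get {A : Type} (l : List A) :
    ∑ a : Fin l.length, ({l.get a} : Multiset A) = (l : Multiset A) := by
  induction l with
  | nil => simp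
  | cons x l ih =>
    have h := Fin.sum_univ_succ (fun a : Fin (l.length + 1) =>
      ({(x :: l).get a} : Multiset A))
    refine h.trans ?_
    change ({x} : Multiset A) + ∑ a : Fin l.length, {l.get a} = _
    rw [ih, Multiset.singleton_add, Multiset.cons_coe]

theorem isWeightedHomogeneous_minor {m n : ℕ} (I : List (Fin m)) (J : List (Fin n)) :
    (minor I J).IsWeightedHomogeneous varWeight
      ((I : Multiset (Fin m)), (J : Multiset (Fin n))) := by
  unfold minor
  split_ifs with h
  · rw [Matrix.det_apply]
    apply MvPolynomial.IsWeightedHomogeneous.sum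
    intro τ _
    have hp := MvPolynomial.IsWeightedHomogeneous.prod (R := ℂ) (w := varWeight)
      (Finset.univ : Finset (Fin I.length))
      (fun a => MvPolynomial.X (I.get (τ a), J.get (Fin.cast h a)))
      (fun a => varWeight (I.get (τ a), J.get (Fin.cast h a)))
      (fun a _ => MvPolynomial.isWeightedHomogeneous_X ℂ _ _)
    have hI : ∑ a : Fin I.length, ({I.get (τ a)} : Multiset (Fin m)) = I := by
      rw [Equiv.sum_comp τ (fun a => ({I.get a} : Multiset (Fin m))), sum_get I]
    have hJ : ∑ a : Fin I.length, ({J.get (Fin.cast h a)} : Multiset (Fin n)) = J := by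
      rw [← sum_get J]
      exact Equiv.sum_comp (finCongr h) (fun a => ({J.get a} : Multiset (Fin n)))
    have hw : ∑ a : Fin I.length, varWeight (I.get (τ a), J.get (Fin.cast h a))
        = ((I : Multiset (Fin m)), (J : Multiset (Fin n))) := by
      refine Prod.ext ?_ ?_
      · rw [Prod.fst_sum]
        exact hI
      · rw [Prod.snd_sum]
        exact hJ
    rw [hw] at hp
    rcases Int.units_eq_one_or (Equiv.Perm.sign τ) with hs | hs
    · rw [hs, one_smul]
      exact hp
    · rw [hs, Units.neg_smul, one_smul]
      exact hp.neg
  · exact MvPolynomial.isWeightedHomogeneous_zero ℂ _ _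

theorem isWeightedHomogeneous_bitableau {m n : ℕ} (P : Tableau (Fin m)) (Q : Tableau (Fin n)) :
    (bitableau P Q).IsWeightedHomogeneous varWeight
      ((P.flatten : Multiset (Fin m)), (Q.flatten : Multiset (Fin n))) := by
  have hp := MvPolynomial.IsWeightedHomogeneous.prod (R := ℂ) (w := varWeight)
    (Finset.range (max (numColumns P) (numColumns Q)))
    (fun c => minor (column c P) (column c Q)) _
    (fun c _ => isWeightedHomogeneous_minor (column c P) (column c Q))
  have hw : ∑ c ∈ Finset.range (max (numColumns P) (numColumns Q)),
      ((column c P : Multiset (Fin m)), (column c Q : Multiset (Fin n)))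
        = ((P.flatten : Multiset (Fin m)), (Q.flatten : Multiset (Fin n))) := by
    refine Prod.ext ?_ ?_
    · rw [Prod.fst_sum]
      exact sum_column P _ (le_max_left _ _)
    · rw [Prod.snd_sum]
      exact sum_column Q _ (le_max_right _ _)
  rw [hw] at hp
  exact hp

theorem operator_zMonomial {m n : ℕ} (α : Matrix (Fin m) (Fin n) ℕ) :
    operator m n (zMonomial α) = bitableau (rsk α).1 (rsk α).2 := by
  have h : zMonomial α = MvPolynomial.basisMonomials (Fin m × Fin n) ℂ (exponent α) := by
    rw [MvPolynomial.coe_basisMonomials]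
    rfl
  rw [h, operator, Module.Basis.constr_basis]
  rfl

theorem margins_eq_of_weight_eq {m n : ℕ} {α β : Matrix (Fin m) (Fin n) ℕ}
    (h : Finsupp.weight varWeight (exponent α) = Finsupp.weight varWeight (exponent β)) :
    (∀ i, ∑ j, α i j = ∑ j, β i j) ∧ (∀ j, ∑ i, α i j = ∑ i, β i j) := by
  rw [weight_exponent, weight_exponent, Prod.mk.injEq] at h
  constructor
  · intro i
    have h1 := congrArg (Multiset.count i) h.1
    simpa [Multiset.count_sum', Multiset.count_singleton] using h1
  · intro j
    have h2 := congrArg (Multiset.count j) h.2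
    simpa [Multiset.count_sum', Multiset.count_singleton] using h2

theorem operator_zMonomial_mem {m n : ℕ} {σ : Fin m → ℕ} {π : Fin n → ℕ} (α : Cont σ π) :
    operator m n (zMonomial α.1) ∈ weightSpace σ π := by
  have hh := isWeightedHomogeneous_bitableau (rsk α.1).1 (rsk α.1).2
  rw [rsk_content] at hh
  rw [operator_zMonomial, MvPolynomial.as_sum (bitableau (rsk α.1).1 (rsk α.1).2)]
  refine Submodule.sum_mem _ fun e he => ?_
  have hw := hh (MvPolynomial.mem_support_iff.mp he)
  have hexp : exponent (Matrix.of fun (i : Fin m) (j : Fin n) => e (i, j)) = e := by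
    ext x
    rfl
  rw [← hexp] at hw
  obtain ⟨h1, h2⟩ := margins_eq_of_weight_eq hw
  have hmem : zMonomial (Matrix.of fun (i : Fin m) (j : Fin n) => e (i, j)) ∈ weightSpace σ π :=
    Submodule.subset_span
      ⟨⟨_, fun i => (h1 i).trans (α.2.1 i), fun j => (h2 j).trans (α.2.2 j)⟩, rfl⟩
  have := Submodule.smul_mem _
    (MvPolynomial.coeff e (bitableau (rsk α.1).1 (rsk α.1).2)) hmem
  rw [zMonomial, hexp, MvPolynomial.smul_monomial, smul_eq_mul, mul_one] at this
  exact this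

theorem operator_mem_weightSpace {m n : ℕ} (σ : Fin m → ℕ) (π : Fin n → ℕ) :
    ∀ f ∈ weightSpace σ π, operator m n f ∈ weightSpace σ π := by
  intro f hf
  refine Submodule.span_induction ?_ ?_ ?_ ?_ hf
  · rintro _ ⟨α, rfl⟩
    exact operator_zMonomial_mem α
  · rw [map_zero]
    exact Submodule.zero_mem _
  · intro x y _ _ hx hy
    rw [map_add]
    exact Submodule.add_mem _ hx hy
  · intro a x _ hx
    rw [map_smul]
    exact Submodule.smul_mem _ a hx

theorem operator_mem_degreeSpace (m n d : ℕ) :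
    ∀ f ∈ degreeSpace m n d, operator m n f ∈ degreeSpace m n d := by
  intro f hf
  refine Submodule.span_induction ?_ ?_ ?_ ?_ hf
  · rintro _ ⟨α, rfl⟩
    have hle : weightSpace (fun i => ∑ j, α.1 i j) (fun j => ∑ i, α.1 i j)
        ≤ degreeSpace m n d := by
      refine Submodule.span_le.mpr ?_
      rintro _ ⟨β, rfl⟩
      refine Submodule.subset_span ⟨⟨β.1, ?_⟩, rfl⟩
      exact (Finset.sum_congr rfl fun i _ => β.2.1 i).trans α.2
    exact hle (operator_zMonomial_mem ⟨α.1, fun _ => rfl, fun _ => rfl⟩)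
  · rw [map_zero]
    exact Submodule.zero_mem _
  · intro x y _ _ hx hy
    rw [map_add]
    exact Submodule.add_mem _ hx hy
  · intro a x _ hx
    rw [map_smul]
    exact Submodule.smul_mem _ a hx

/-! ### The restrictions, the monomial bases, and the matrices -/

/-- The restriction of the operator to the space of degree `d`. -/
noncomputable def degreeOperator (m n d : ℕ) : degreeSpace m n d →ₗ[ℂ] degreeSpace m n d :=
  (operator m n).restrict (operator_mem_degreeSpace m n d)

/-- The restriction of the operator to the weight space of `(σ, π)`. -/
noncomputable def weightOperator {m n : ℕ} (σ : Fin m → ℕ) (π : Fin n → ℕ) :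
    weightSpace σ π →ₗ[ℂ] weightSpace σ π :=
  (operator m n).restrict (operator_mem_weightSpace σ π)

theorem linearIndependent_zMonomial (m n : ℕ) :
    LinearIndependent ℂ (zMonomial : Matrix (Fin m) (Fin n) ℕ → CoordRing m n) := by
  have h := (MvPolynomial.basisMonomials (Fin m × Fin n) ℂ).linearIndependent
  refine h.comp exponent ?_
  intro α β hαβ
  ext i j
  exact DFunLike.congr_fun hαβ (i, j)

/-- The basis of monomials of the space of degree `d`. -/
noncomputable def degreeBasis (m n d : ℕ) :
    Module.Basis (DegreeTable m n d) ℂ (degreeSpace m n d) :=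
  Module.Basis.span ((linearIndependent_zMonomial m n).comp Subtype.val Subtype.val_injective)

/-- The basis of monomials of the weight space of `(σ, π)`. -/
noncomputable def weightBasis {m n : ℕ} (σ : Fin m → ℕ) (π : Fin n → ℕ) :
    Module.Basis (Cont σ π) ℂ (weightSpace σ π) :=
  Module.Basis.span ((linearIndependent_zMonomial m n).comp Subtype.val Subtype.val_injective)

instance instFiniteDegreeTable (m n d : ℕ) : Finite (DegreeTable m n d) := by
  refine Finite.of_injective (β := Fin m → Fin n → Fin (d + 1))
    (fun α i j => ⟨α.1 i j, ?_⟩) ?_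
  · have h1 : α.1 i j ≤ ∑ j, α.1 i j :=
      Finset.single_le_sum (fun _ _ => Nat.zero_le _) (Finset.mem_univ j)
    have h2 : ∑ j, α.1 i j ≤ ∑ i, ∑ j, α.1 i j :=
      Finset.single_le_sum (f := fun i => ∑ j, α.1 i j)
        (fun _ _ => Nat.zero_le _) (Finset.mem_univ i)
    exact Nat.lt_succ_of_le ((h1.trans h2).trans α.2.le)
  · intro α β h
    refine Subtype.ext ?_
    ext i j
    exact Fin.mk.inj_iff.mp (congrFun (congrFun h i) j)

instance instFiniteCont {m n : ℕ} (σ : Fin m → ℕ) (π : Fin n → ℕ) : Finite (Cont σ π) :=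
  Finite.of_injective (β := DegreeTable m n (∑ i, σ i))
    (fun α => ⟨α.1, Finset.sum_congr rfl fun i _ => α.2.1 i⟩)
    fun _ _ h => Subtype.ext (Subtype.mk.inj h)

noncomputable instance instFintypeDegreeTable (m n d : ℕ) : Fintype (DegreeTable m n d) :=
  Fintype.ofFinite _

noncomputable instance instFintypeCont {m n : ℕ} (σ : Fin m → ℕ) (π : Fin n → ℕ) :
    Fintype (Cont σ π) :=
  Fintype.ofFinite _

/-- The matrix `RSK_{m,n,d}`: the restriction of the operator to the space of degree `d`, in the
basis of monomials. -/
noncomputable def degreeMatrix (m n d : ℕ) :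
    Matrix (DegreeTable m n d) (DegreeTable m n d) ℂ :=
  LinearMap.toMatrix (degreeBasis m n d) (degreeBasis m n d) (degreeOperator m n d)

/-- The matrix `RSK_{σ,π}`: the restriction of the operator to the weight space of `(σ, π)`, in
the basis of monomials. -/
noncomputable def weightMatrix {m n : ℕ} (σ : Fin m → ℕ) (π : Fin n → ℕ) :
    Matrix (Cont σ π) (Cont σ π) ℂ :=
  LinearMap.toMatrix (weightBasis σ π) (weightBasis σ π) (weightOperator σ π)

end RSKOperator

namespace RSKOperator

/-! ### Row insertion, and the recursion of RSK over the rows -/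

section Insertion

variable {A B : Type} [LinearOrder A]

/-! The matrices have integer entries, so it suffices that no prime `p` divides the determinant,
that is, that the bitableaux `[P|Q]` attached to distinct exponent matrices are linearly independent
over `ZMod p`. In characteristic zero alone this would only give a nonzero determinant; the
independence argument works over every domain, and this is what forces the value `±1`.

Two facts carry the independence. The first is combinatorial: `rsk` is injective and its values are
pairs of semistandard tableaux of equal shape (`rsk_injective`, `isSemistandard_rsk`). Both are
proved one row at a time: the rows below the first are produced by inserting the bumped biletters,
which again form a sorted biword (`insertWord_eq_cons`, `pairwise_rowRun_snd`). Surjectivity of RSK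
is never needed, since independence makes a square matrix over a field invertible.

The second is a leading term computation. Substitute for the generic matrix a product `xy` of
generic `m × m` and `m × n` matrices. By the Cauchy–Binet expansion and a suitable lexicographic
order, the minor with rows `i₀ < i₁ < ...` and columns `j₀ < j₁ < ...` has leading term `∏ x_{i_k,k}
y_{k,j_k}` with coefficient 1. Multiplying over the columns of a bitableau, the exponents of
`x_{i,k}` and `y_{k,j}` count the entries `i` in row `k` of `P` and `j` in row `k` of `Q`
(`leading_ringBitableau`). A semistandard tableau is determined by these counts, so distinct pairs
have distinct monic leading terms (`linearIndependent_ringBitableau_rsk`). -/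

theorem exists_rowInsert_position (p : A) (r : List A) :
    ∃ c, c ≤ r.length ∧ (∀ i x, i < c → r[i]? = some x → x ≤ p) ∧
      (∀ i, (rowInsert p r).1[i]? = if i = c then some p else r[i]?) ∧
      (rowInsert p r).2 = r[c]? ∧ ∀ y, r[c]? = some y → p < y := by
  induction r with
  | nil =>
    refine ⟨0, by simp, by simp, ?_, by simp [rowInsert], by simp⟩
    intro i
    cases i <;> simp [rowInsert]
  | cons x xs ih =>
    by_cases h : p < x
    · refine ⟨0, by simp, by simp, ?_, by simp [rowInsert, h], by simpa using h⟩
      intro i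
      cases i <;> simp [rowInsert, h]
    · obtain ⟨c, h1, h2, h3, h4, h5⟩ := ih
      refine ⟨c + 1, by simpa using h1, ?_, ?_, by simpa [rowInsert, h] using h4, by simpa using h5⟩
      · intro i y hi hy
        cases i with
        | zero => simp at hy; exact hy ▸ not_lt.mp h
        | succ i => exact h2 i y (by omega) (by simpa using hy)
      · intro i
        cases i with
        | zero => simp [rowInsert, h]
        | succ i => simpa [rowInsert, h] using h3 i

/-- The state of the first rows of `P` and `Q`, and of the biletters bumped out of them so far. -/
abbrev RowState (A B : Type) : Type := (List A × List B) × List (A × B)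

/-- One insertion into the first rows, recording the biletter passed on to the rows below. -/
def rowStep (st : RowState A B) (x : A × B) : RowState A B :=
  match rowInsert x.1 st.1.1 with
  | (r', none) => ((r', st.1.2 ++ [x.2]), st.2)
  | (r', some y) => ((r', st.1.2), st.2 ++ [(y, x.2)])

/-- The first rows and the bumped biletters of a successive insertion. -/
def rowRun (w : List (A × B)) : RowState A B := w.foldl rowStep (([], []), [])

theorem rowRun_concat (w : List (A × B)) (x : A × B) :
    rowRun (w ++ [x]) = rowStep (rowRun w) x := by
  simp [rowRun]

/-- The two possible outcomes of an insertion into a row, described by the entries. -/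
theorem rowStep_cases (st : RowState A B) (x : A × B) :
    (rowStep st x = ((st.1.1 ++ [x.1], st.1.2 ++ [x.2]), st.2) ∧ ∀ z ∈ st.1.1, z ≤ x.1) ∨
    ∃ (c : ℕ) (y : A) (r' : List A), rowStep st x = ((r', st.1.2), st.2 ++ [(y, x.2)]) ∧ st.1.1[c]? = some y ∧ x.1 < y ∧
      (∀ i z, i < c → st.1.1[i]? = some z → z ≤ x.1) ∧
      (∀ i, r'[i]? = if i = c then some x.1 else st.1.1[i]?) := by
  obtain ⟨c, h1, h2, h3, h4, h5⟩ := exists_rowInsert_position x.1 st.1.1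
  rcases hr : rowInsert x.1 st.1.1 with ⟨r', _ | y⟩
  · left
    rw [hr] at h3 h4
    have hc : c = st.1.1.length := by
      have := List.getElem?_eq_none_iff.mp h4.symm
      omega
    subst hc
    constructor
    · have : r' = st.1.1 ++ [x.1] := by
        apply List.ext_getElem?
        intro i
        rw [h3 i]
        split_ifs with hi
        · simp [hi]
        · rcases lt_or_gt_of_ne hi with hi | hi
          · rw [List.getElem?_append_left hi]
          · rw [List.getElem?_eq_none hi.le, List.getElem?_eq_none (by simpa using hi)]
      simp [rowStep, hr, this]
    · intro z hz
      obtain ⟨i, hi⟩ := List.mem_iff_getElem?.mp hz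
      exact h2 i z (List.getElem?_eq_some_iff.mp hi).1 hi
  · right
    rw [hr] at h3 h4
    exact ⟨c, y, r', by simp [rowStep, hr], h4.symm, h5 y h4.symm, h2, h3⟩

/-- The first row never looks at the rows below it, and those see only the biletters bumped from it,
in the order of bumping; `b` is the part of that list contributed by `w`. -/
theorem foldl_insertBiletter_cons (w : List (A × B)) (st : RowState A B)
    (T : List (List A × List B)) :
    ∃ b, (w.foldl rowStep st).2 = st.2 ++ b ∧
    w.foldl (fun T x => insertBiletter x.1 x.2 T) (st.1 :: T) =
      (w.foldl rowStep st).1 :: b.foldl (fun T x => insertBiletter x.1 x.2 T) T := by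
  induction w generalizing st T with
  | nil => exact ⟨[], by simp⟩
  | cons x w ih =>
    obtain ⟨⟨r, s⟩, b0⟩ := st
    simp only [List.foldl_cons]
    rcases hr : rowInsert x.1 r with ⟨r', _ | y⟩
    · obtain ⟨b, h1, h2⟩ := ih ((r', s ++ [x.2]), b0) T
      exact ⟨b, by simpa [rowStep, hr] using h1, by simpa [rowStep, insertBiletter, hr] using h2⟩
    · obtain ⟨b, h1, h2⟩ := ih ((r', s), b0 ++ [(y, x.2)]) (insertBiletter y x.2 T)
      exact ⟨(y, x.2) :: b, by simpa [rowStep, hr] using h1,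
        by simpa [rowStep, insertBiletter, hr] using h2⟩

theorem insertWord_nil : insertWord ([] : List (A × B)) = [] := rfl

/-- The recursion behind the later inductions: the bumped word is strictly shorter
(`length_rowRun_snd_lt`), so statements about `insertWord` reduce to statements about the first row.
-/
theorem insertWord_eq_cons {w : List (A × B)} (hw : w ≠ []) :
    insertWord w = (rowRun w).1 :: insertWord (rowRun w).2 := by
  obtain ⟨x, w, rfl⟩ := List.exists_cons_of_ne_nil hw
  obtain ⟨b, h1, h2⟩ := foldl_insertBiletter_cons w (([x.1], [x.2]), []) []
  have : rowStep (([], []), []) x = (([x.1], [x.2]), []) := by simp [rowStep, rowInsert]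
  simp only [insertWord, rowRun, List.foldl_cons, this, insertBiletter]
  rw [h2, h1]
  simp

theorem length_rowRun (w : List (A × B)) :
    (rowRun w).1.1.length = (rowRun w).1.2.length ∧
      (rowRun w).1.1.length + (rowRun w).2.length = w.length := by
  induction w using List.reverseRecOn with
  | nil => simp [rowRun]
  | append_singleton w x ih =>
    rw [rowRun_concat]
    rcases rowStep_cases (rowRun w) x with ⟨h, _⟩ | ⟨c, y, r', h, hc, _, _, h3⟩
    · rw [h]
      simp only [List.length_append, List.length_singleton]
      omega
    · have hl : r'.length = (rowRun w).1.1.length := by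
        have hc' := (List.getElem?_eq_some_iff.mp hc).1
        apply le_antisymm
        · rw [← List.getElem?_eq_none_iff, h3, if_neg (by omega)]
          simp
        · by_contra hlt
          push Not at hlt
          have h4 := h3 r'.length
          rw [List.getElem?_eq_none le_rfl] at h4
          split_ifs at h4 with h5
          rw [eq_comm, List.getElem?_eq_none_iff] at h4
          omega
      rw [h]
      simp only [List.length_append, List.length_singleton, hl]
      omega

theorem rowRun_fst_ne_nil {w : List (A × B)} (hw : w ≠ []) : (rowRun w).1.1 ≠ [] := by
  induction w using List.reverseRecOn with
  | nil => exact absurd rfl hw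
  | append_singleton w x ih =>
    rw [rowRun_concat]
    rcases rowStep_cases (rowRun w) x with ⟨h, _⟩ | ⟨c, y, r', h, hc, _, _, h3⟩
    · simp [h]
    · rw [h]
      intro h0
      have := h3 c
      simp only at h0
      simp [h0] at this

theorem length_rowRun_snd_lt {w : List (A × B)} (hw : w ≠ []) :
    (rowRun w).2.length < w.length := by
  have h1 := length_rowRun w
  have h2 := List.length_pos_iff.mpr (rowRun_fst_ne_nil hw)
  omega

theorem mem_labels_rowRun (w : List (A × B)) (q : B) :
    q ∈ w.map Prod.snd ↔ q ∈ (rowRun w).1.2 ∨ q ∈ (rowRun w).2.map Prod.snd := by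
  induction w using List.reverseRecOn with
  | nil => simp [rowRun]
  | append_singleton w x ih =>
    rw [rowRun_concat, List.map_append, List.mem_append, ih]
    rcases rowStep_cases (rowRun w) x with ⟨h, _⟩ | ⟨c, y, r', h, hc, _, _, h3⟩
    · rw [h]
      simp only [List.mem_append, List.map_cons, List.map_nil, List.mem_singleton]
      tauto
    · rw [h]
      simp only [List.mem_append, List.map_append, List.map_cons, List.map_nil,
        List.mem_singleton]
      tauto

theorem pairwise_le_rowRun (w : List (A × B)) : (rowRun w).1.1.Pairwise (· ≤ ·) := by
  induction w using List.reverseRecOn with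
  | nil => simp [rowRun]
  | append_singleton w x ih =>
    rw [rowRun_concat]
    rcases rowStep_cases (rowRun w) x with ⟨h, hle⟩ | ⟨c, y, r', h, hc, hxy, h2, h3⟩
    · rw [h]
      simpa [List.pairwise_append] using ⟨ih, hle⟩
    · rw [h]
      have key : ∀ (i j : ℕ) a b, i < j → (rowRun w).1.1[i]? = some a →
          (rowRun w).1.1[j]? = some b → a ≤ b := by
        intro i j a b hij ha hb
        obtain ⟨hi, rfl⟩ := List.getElem?_eq_some_iff.mp ha
        obtain ⟨hj, rfl⟩ := List.getElem?_eq_some_iff.mp hb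
        exact List.pairwise_iff_getElem.mp ih i j hi hj hij
      rw [List.pairwise_iff_getElem]
      intro i j hi hj hij
      have ei := h3 i
      have ej := h3 j
      simp only at hi hj
      rw [List.getElem?_eq_getElem hi] at ei
      rw [List.getElem?_eq_getElem hj] at ej
      split_ifs at ei with hic
      · rw [if_neg (by omega)] at ej
        simp only [Option.some.injEq] at ei
        rw [ei]
        exact hxy.le.trans (key c j y _ (by omega) hc ej.symm)
      · split_ifs at ej with hjc
        · simp only [Option.some.injEq] at ej
          rw [ej]
          exact h2 i _ (by omega) ei.symm
        · exact key i j _ _ hij ei.symm ej.symm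

end Insertion

/-! ### Sorted biwords: semistandardness and injectivity of insertion -/

section Biletters

variable {A B : Type} [LinearOrder A] [LinearOrder B]

/-- The order in which biletters are read: by columns, and down each column. -/
def BiletterLE (x y : A × B) : Prop := x.2 < y.2 ∨ x.2 = y.2 ∧ x.1 ≤ y.1

theorem BiletterLE.refl (x : A × B) : BiletterLE x x := Or.inr ⟨rfl, le_rfl⟩

theorem BiletterLE.snd_le {x y : A × B} (h : BiletterLE x y) : x.2 ≤ y.2 :=
  h.elim le_of_lt fun h => h.1.le

/-- If the letters read so far are at most `(p, q)`, then the ones with label `q` behave as an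
initial part of a weakly increasing insertion. -/
theorem rowRun_label_bounds {w : List (A × B)} (hw : w.Pairwise BiletterLE) {p : A} {q : B}
    (hpq : ∀ x ∈ w, BiletterLE x (p, q)) :
    (q ∈ (rowRun w).1.2 → ∀ z ∈ (rowRun w).1.1, z ≤ p) ∧
      ∀ y, (y, q) ∈ (rowRun w).2 → ∀ z ∈ (rowRun w).1.1, p < z → y ≤ z := by
  induction w using List.reverseRecOn generalizing p q with
  | nil => simp [rowRun]
  | append_singleton w x ih =>
    have hw' := (List.pairwise_append.mp hw).1
    have hwx : ∀ y ∈ w, BiletterLE y (x.1, x.2) := fun y hy =>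
      (List.pairwise_append.mp hw).2.2 y hy x (by simp)
    obtain ⟨ih1, ih2⟩ := ih hw' hwx
    have hx : BiletterLE x (p, q) := hpq x (by simp)
    rcases hx with hx | ⟨hx1, hx2⟩
    -- All labels read so far are below `q`, so both claims are vacuous.
    · have hq : q ∉ (w ++ [x]).map Prod.snd := by
        intro h
        obtain ⟨y, hy, rfl⟩ := List.mem_map.mp h
        rcases List.mem_append.mp hy with hy | hy
        · exact absurd ((hwx y hy).snd_le) (not_le.mpr hx)
        · simp only [List.mem_singleton] at hy
          subst hy
          exact lt_irrefl _ hx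
      rw [mem_labels_rowRun, not_or] at hq
      exact ⟨fun h => absurd h hq.1, fun y hy => absurd (List.mem_map_of_mem hy) hq.2⟩
    · simp only at hx1 hx2
      subst hx1
      rw [rowRun_concat]
      rcases rowStep_cases (rowRun w) x with ⟨h, hle⟩ | ⟨c, y, r', h, hc, hxy, h2, h3⟩
      · rw [h]
        have : ∀ z ∈ (rowRun w).1.1 ++ [x.1], z ≤ p := by
          intro z hz
          rcases List.mem_append.mp hz with hz | hz
          · exact (hle z hz).trans hx2
          · simp only [List.mem_singleton] at hz
            exact hz ▸ hx2
        exact ⟨fun _ => this, fun y _ z hz hpz => absurd (this z hz) (not_le.mpr hpz)⟩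
      · rw [h]
        have hy : y ∈ (rowRun w).1.1 := List.mem_of_getElem? hc
        refine ⟨fun hq => absurd (ih1 hq y hy) (not_le.mpr hxy), ?_⟩
        intro y' hy' z hz hpz
        obtain ⟨i, hi⟩ := List.mem_iff_getElem?.mp hz
        simp only at hi hy'
        rw [h3] at hi
        split_ifs at hi with hic
        · simp only [Option.some.injEq] at hi
          exact absurd (hi ▸ hx2) (not_le.mpr hpz)
        · have hzr : z ∈ (rowRun w).1.1 := List.mem_of_getElem? hi
          have hxz : x.1 < z := hx2.trans_lt hpz
          rcases List.mem_append.mp hy' with hy' | hy'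
          · exact ih2 y' hy' z hzr hxz
          · simp only [List.mem_singleton, Prod.mk.injEq] at hy'
            rw [hy'.1]
            -- Entries to the left of the bumped position are at most `x.1 < z`, so `z` sits to its
            -- right and sortedness of the old row gives `y ≤ z`.
            have hci : c < i := by
              by_contra hlt
              exact absurd (h2 i z (by omega) hi) (not_le.mpr hxz)
            obtain ⟨hi', rfl⟩ := List.getElem?_eq_some_iff.mp hi
            obtain ⟨hc', rfl⟩ := List.getElem?_eq_some_iff.mp hc
            exact List.pairwise_iff_getElem.mp (pairwise_le_rowRun w) c i hc' hi' hci

/-- The label of a letter that bumps is new in the first row of `Q`. -/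
theorem lt_of_mem_of_bump {w : List (A × B)} (hw : w.Pairwise BiletterLE) {p : A} {q : B}
    (hpq : ∀ x ∈ w, BiletterLE x (p, q)) {y : A} (hy : y ∈ (rowRun w).1.1) (hpy : p < y) :
    ∀ t ∈ (rowRun w).1.2, t < q := by
  intro t ht
  have h1 : t ∈ w.map Prod.snd := (mem_labels_rowRun w t).mpr (Or.inl ht)
  obtain ⟨x, hx, rfl⟩ := List.mem_map.mp h1
  refine lt_of_le_of_ne (hpq x hx).snd_le ?_
  intro h
  exact absurd ((rowRun_label_bounds hw hpq).1 (h ▸ ht) y hy) (not_le.mpr hpy)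

/-- Bumped biletters keep their labels in reading order, and those with a common label are bumped in
weakly increasing order by `rowRun_label_bounds`. Hence the word passed to the next row satisfies
the same hypothesis as `w`. -/
theorem pairwise_rowRun_snd {w : List (A × B)} (hw : w.Pairwise BiletterLE) :
    (rowRun w).2.Pairwise BiletterLE := by
  induction w using List.reverseRecOn with
  | nil => simp [rowRun]
  | append_singleton w x ih =>
    have hw' := (List.pairwise_append.mp hw).1
    have hwx : ∀ y ∈ w, BiletterLE y (x.1, x.2) := fun y hy =>
      (List.pairwise_append.mp hw).2.2 y hy x (by simp)
    rw [rowRun_concat]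
    rcases rowStep_cases (rowRun w) x with ⟨h, hle⟩ | ⟨c, y, r', h, hc, hxy, h2, h3⟩
    · rw [h]
      exact ih hw'
    · rw [h]
      refine List.pairwise_append.mpr ⟨ih hw', by simp, ?_⟩
      rintro ⟨y', q'⟩ hy' z hz
      simp only [List.mem_singleton] at hz
      subst hz
      have h1 : q' ∈ w.map Prod.snd :=
        (mem_labels_rowRun w q').mpr (Or.inr (List.mem_map_of_mem hy'))
      obtain ⟨u, hu, hu'⟩ := List.mem_map.mp h1
      subst hu'
      rcases lt_or_eq_of_le (hwx u hu).snd_le with hlt | heq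
      · exact Or.inl hlt
      · refine Or.inr ⟨heq, ?_⟩
        simp only at heq
        rw [heq] at hy'
        exact (rowRun_label_bounds hw' hwx).2 y' hy' y (List.mem_of_getElem? hc) hxy

theorem pairwise_le_rowRun_labels {w : List (A × B)} (hw : w.Pairwise BiletterLE) :
    (rowRun w).1.2.Pairwise (· ≤ ·) := by
  induction w using List.reverseRecOn with
  | nil => simp [rowRun]
  | append_singleton w x ih =>
    have hw' := (List.pairwise_append.mp hw).1
    rw [rowRun_concat]
    rcases rowStep_cases (rowRun w) x with ⟨h, hle⟩ | ⟨c, y, r', h, hc, hxy, h2, h3⟩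
    · rw [h]
      refine List.pairwise_append.mpr ⟨ih hw', by simp, ?_⟩
      intro t ht u hu
      simp only [List.mem_singleton] at hu
      subst hu
      obtain ⟨v, hv, rfl⟩ := List.mem_map.mp ((mem_labels_rowRun w t).mpr (Or.inl ht))
      exact ((List.pairwise_append.mp hw).2.2 v hv x (by simp)).snd_le
    · rw [h]
      exact ih hw'

/-- Every entry of the lower row lies strictly below an entry of the upper row that is smaller. -/
def ColumnStrict {C : Type} [LinearOrder C] (r r' : List C) : Prop :=
  ∀ (c : ℕ) (y : C), r'[c]? = some y → ∃ x, r[c]? = some x ∧ x < y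

theorem ColumnStrict.trans {C : Type} [LinearOrder C] {r r' r'' : List C}
    (h : ColumnStrict r r') (h' : ColumnStrict r' r'') : ColumnStrict r r'' := by
  intro c y hy
  obtain ⟨x, hx, hxy⟩ := h' c y hy
  obtain ⟨z, hz, hzx⟩ := h c x hx
  exact ⟨z, hz, hzx.trans hxy⟩

theorem ColumnStrict.length_le {C : Type} [LinearOrder C] {r r' : List C}
    (h : ColumnStrict r r') : r'.length ≤ r.length := by
  by_contra hlt
  push Not at hlt
  obtain ⟨x, hx, _⟩ := h r.length _ (List.getElem?_eq_getElem hlt)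
  simp at hx

theorem ColumnStrict.concat_left {C : Type} [LinearOrder C] {r r' : List C}
    (h : ColumnStrict r r') (z : C) : ColumnStrict (r ++ [z]) r' := by
  intro c y hy
  obtain ⟨x, hx, hxy⟩ := h c y hy
  exact ⟨x, by rw [List.getElem?_append_left (List.getElem?_eq_some_iff.mp hx).1, hx], hxy⟩

/-- A letter `y` bumped from column `c` lands in the next row in a column `d ≤ c`, because an entry
below `y` exceeds `y`; after the bump, the upper row is smaller than `y` in all columns up to `c`.
For `Q`, a bumping letter has a label larger than every label in the first row, so a box added below
it is strictly larger than the box above. -/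
theorem columnStrict_rowRun {w : List (A × B)} (hw : w.Pairwise BiletterLE) :
    ColumnStrict (rowRun w).1.1 (rowRun (rowRun w).2).1.1 ∧
      ColumnStrict (rowRun w).1.2 (rowRun (rowRun w).2).1.2 := by
  induction w using List.reverseRecOn with
  | nil => simp [rowRun, ColumnStrict]
  | append_singleton w x ih =>
    have hw' := (List.pairwise_append.mp hw).1
    have hwx : ∀ y ∈ w, BiletterLE y (x.1, x.2) := fun y hy =>
      (List.pairwise_append.mp hw).2.2 y hy x (by simp)
    obtain ⟨ih1, ih2⟩ := ih hw'
    have hlen := (length_rowRun w).1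
    have hlen' := (length_rowRun (rowRun w).2).1
    rw [rowRun_concat]
    rcases rowStep_cases (rowRun w) x with ⟨h, hle⟩ | ⟨c, y, r', h, hc, hxy, h2, h3⟩
    · rw [h]
      exact ⟨ih1.concat_left _, ih2.concat_left _⟩
    · rw [h]
      simp only
      rw [rowRun_concat]
      have hcl := (List.getElem?_eq_some_iff.mp hc).1
      have hlabel := lt_of_mem_of_bump hw' hwx (List.mem_of_getElem? hc) hxy
      -- the entries of the new upper row are below the old ones
      have hdown : ∀ (i : ℕ) (z : A), (rowRun w).1.1[i]? = some z → ∃ z', r'[i]? = some z' ∧ z' ≤ z := by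
        intro i z hz
        rw [h3]
        split_ifs with hic
        · subst hic
          rw [hc] at hz
          exact ⟨_, rfl, by simpa using (Option.some.inj hz) ▸ hxy.le⟩
        · exact ⟨z, hz, le_rfl⟩
      have hsmall : ∀ i : ℕ, i ≤ c → ∃ z, r'[i]? = some z ∧ z < y := by
        intro i hi
        rw [h3]
        split_ifs with hic
        · exact ⟨_, rfl, hxy⟩
        · refine ⟨_, List.getElem?_eq_getElem (by omega), ?_⟩
          exact (h2 i _ (by omega) (List.getElem?_eq_getElem (by omega))).trans_lt hxy
      have hcs : ∀ i : ℕ, i ≤ c → ∃ z, (rowRun w).1.2[i]? = some z ∧ z < x.2 := by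
        intro i hi
        have hi' : i < (rowRun w).1.2.length := by omega
        exact ⟨_, List.getElem?_eq_getElem hi', hlabel _ (List.getElem_mem hi')⟩
      rcases rowStep_cases (rowRun (rowRun w).2) (y, x.2) with
        ⟨g, gle⟩ | ⟨d, u, t', g, gd, gxu, g2, g3⟩
      -- If the lower row reached column `c`, its entry there would exceed `y` and would have been
      -- bumped.
      · have hd : (rowRun (rowRun w).2).1.1.length ≤ c := by
          by_contra hlt
          push Not at hlt
          obtain ⟨z, hz, hzy⟩ := ih1 c _ (List.getElem?_eq_getElem hlt)
          rw [hc] at hz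
          obtain rfl := Option.some.inj hz
          exact absurd (gle _ (List.getElem_mem hlt)) (not_le.mpr hzy)
        rw [g]
        constructor
        · intro i z hz
          simp only [List.getElem?_append] at hz
          split_ifs at hz with hi
          · obtain ⟨a, ha, haz⟩ := ih1 i z hz
            obtain ⟨b, hb, hba⟩ := hdown i a ha
            exact ⟨b, hb, hba.trans_lt haz⟩
          · have hi' : i = (rowRun (rowRun w).2).1.1.length := by
              have := (List.getElem?_eq_some_iff.mp hz).1
              simp at this
              omega
            subst hi'
            simp only [Nat.sub_self, List.getElem?_cons_zero, Option.some.injEq] at hz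
            subst hz
            exact hsmall _ hd
        · intro i z hz
          simp only [List.getElem?_append] at hz
          split_ifs at hz with hi
          · exact ih2 i z hz
          · have hi' : i = (rowRun (rowRun w).2).1.2.length := by
              have := (List.getElem?_eq_some_iff.mp hz).1
              simp at this
              omega
            subst hi'
            simp only [Nat.sub_self, List.getElem?_cons_zero, Option.some.injEq] at hz
            subst hz
            exact hcs _ (by omega)
      · have hd : d ≤ c := by
          by_contra hlt
          push Not at hlt
          have hdl := (List.getElem?_eq_some_iff.mp gd).1
          have hcl' : c < (rowRun (rowRun w).2).1.1.length := by omega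
          obtain ⟨z, hz, hzy⟩ := ih1 c _ (List.getElem?_eq_getElem hcl')
          rw [hc] at hz
          obtain rfl := Option.some.inj hz
          exact absurd (g2 c _ hlt (List.getElem?_eq_getElem hcl')) (not_le.mpr hzy)
        rw [g]
        refine ⟨?_, ih2⟩
        intro i z hz
        simp only [g3] at hz
        split_ifs at hz with hi
        · obtain rfl := Option.some.inj hz
          exact hsmall i (hi ▸ hd)
        · obtain ⟨a, ha, haz⟩ := ih1 i z hz
          obtain ⟨b, hb, hba⟩ := hdown i a ha
          exact ⟨b, hb, hba.trans_lt haz⟩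

/-- Semistandard tableaux without empty rows. -/
structure IsSemistandard {C : Type} [LinearOrder C] (T : Tableau C) : Prop where
  ne_nil : ∀ r ∈ T, r ≠ []
  row : ∀ r ∈ T, r.Pairwise (· ≤ ·)
  column : T.Pairwise ColumnStrict

theorem IsSemistandard.cons {C : Type} [LinearOrder C] {r : List C} {T : Tableau C}
    (hT : IsSemistandard T) (hr : r ≠ []) (hrow : r.Pairwise (· ≤ ·))
    (h : ∀ r' ∈ T.head?, ColumnStrict r r') : IsSemistandard (r :: T) := by
  refine ⟨?_, ?_, List.pairwise_cons.mpr ⟨?_, hT.column⟩⟩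
  · simpa using ⟨hr, hT.ne_nil⟩
  · simpa using ⟨hrow, hT.row⟩
  · cases T with
    | nil => simp
    | cons r' T =>
      have h1 := h r' (by simp)
      intro t ht
      rcases List.mem_cons.mp ht with rfl | ht
      · exact h1
      · exact h1.trans ((List.pairwise_cons.mp hT.column).1 t ht)

/-- Only consecutive rows have to be compared: `ColumnStrict` is transitive, so
`columnStrict_rowRun` at each level of the row recursion suffices. -/
theorem isSemistandard_insertWord {w : List (A × B)} (hw : w.Pairwise BiletterLE) :
    IsSemistandard ((insertWord w).map Prod.fst) ∧ IsSemistandard ((insertWord w).map Prod.snd) ∧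
      ∀ rs ∈ insertWord w, rs.1.length = rs.2.length := by
  induction hN : w.length using Nat.strong_induction_on generalizing w with
  | _ N ih =>
  subst hN
  by_cases h0 : w = []
  · subst h0
    simp only [insertWord_nil, List.map_nil]
    exact ⟨⟨by simp, by simp, by simp⟩, ⟨by simp, by simp, by simp⟩, by simp⟩
  obtain ⟨i1, i2, i3⟩ := ih _ (length_rowRun_snd_lt h0) (pairwise_rowRun_snd hw) rfl
  have hl := (length_rowRun w).1
  have hr := rowRun_fst_ne_nil h0
  rw [insertWord_eq_cons h0]
  have hc := columnStrict_rowRun hw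
  have hh : ∀ rs ∈ (insertWord (rowRun w).2).head?, rs = (rowRun (rowRun w).2).1 := by
    intro rs hrs
    by_cases h1 : (rowRun w).2 = []
    · simp [h1, insertWord_nil] at hrs
    · rw [insertWord_eq_cons h1] at hrs
      simpa using hrs.symm
  refine ⟨i1.cons hr (pairwise_le_rowRun w) ?_, i2.cons ?_ (pairwise_le_rowRun_labels hw) ?_, ?_⟩
  · intro r' hr'
    rw [List.head?_map] at hr'
    obtain ⟨rs, h1, rfl⟩ := Option.mem_map.mp hr'
    rw [hh rs h1]
    exact hc.1
  · intro h
    exact hr (List.length_eq_zero_iff.mp (by simp [hl, h]))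
  · intro r' hr'
    rw [List.head?_map] at hr'
    obtain ⟨rs, h1, rfl⟩ := Option.mem_map.mp hr'
    rw [hh rs h1]
    exact hc.2
  · intro rs hrs
    rcases List.mem_cons.mp hrs with rfl | hrs
    · exact hl
    · exact i3 rs hrs

/-- The last step can be undone because its type is visible: an appended letter leaves its label in
the row of `Q`, whereas a bumping letter has a label exceeding all labels there. After a bump, the
bumped letter `y` is the last one recorded, and sortedness determines the position to which it
returns. -/
theorem rowStep_left_cancel {st st' : RowState A B} {x x' : A × B}
    (hst : st.1.1.Pairwise (· ≤ ·)) (hst' : st'.1.1.Pairwise (· ≤ ·))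
    (hlab : x.2 = x'.2)
    (hnew : ∀ y ∈ st.1.1, x.1 < y → ∀ t ∈ st.1.2, t < x.2)
    (hnew' : ∀ y ∈ st'.1.1, x'.1 < y → ∀ t ∈ st'.1.2, t < x'.2)
    (h : rowStep st x = rowStep st' x') : st = st' ∧ x = x' := by
  obtain ⟨⟨r, s⟩, b⟩ := st
  obtain ⟨⟨r', s'⟩, b'⟩ := st'
  obtain ⟨p, q⟩ := x
  obtain ⟨p', q'⟩ := x'
  simp only at hlab hst hst' hnew hnew'
  subst hlab
  rcases rowStep_cases ((r, s), b) (p, q) with ⟨g, gle⟩ | ⟨c, y, t, g, gc, gy, g2, g3⟩ <;>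
  rcases rowStep_cases ((r', s'), b') (p', q) with ⟨g', gle'⟩ | ⟨c', y', t', g', gc', gy', g2', g3'⟩
  · rw [g, g'] at h
    simp only [Prod.mk.injEq, List.append_singleton_inj] at h
    simp [h]
  · rw [g, g'] at h
    simp only [Prod.mk.injEq] at h
    have := hnew' y' (List.mem_of_getElem? gc') gy' q (by simp [← h.1.2])
    exact absurd this (lt_irrefl _)
  · rw [g, g'] at h
    simp only [Prod.mk.injEq] at h
    have := hnew y (List.mem_of_getElem? gc) gy q (by simp [h.1.2])
    exact absurd this (lt_irrefl _)
  · rw [g, g'] at h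
    simp only [Prod.mk.injEq, List.append_singleton_inj] at h
    obtain ⟨⟨rfl, rfl⟩, rfl, rfl, -⟩ := h
    simp only at g3 g3' gc gc'
    -- If `c < c'`, then `r` already has `p'` in column `c'`, to the right of `y` in column `c`,
    -- against `p' < y`.
    have aux : ∀ {r r' t : List A} {p p' y : A} {c c' : ℕ}, r.Pairwise (· ≤ ·) →
        (∀ i, t[i]? = if i = c then some p else r[i]?) →
        (∀ i, t[i]? = if i = c' then some p' else r'[i]?) →
        r[c]? = some y → p' < y → r'[c']? = some y → ¬ c < c' := by
      intro r r' t p p' y c c' hr h1 h2 hc hp hc' hlt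
      have e1 := h1 c'
      rw [h2 c', if_pos rfl, if_neg (by omega)] at e1
      obtain ⟨i1, i2⟩ := List.getElem?_eq_some_iff.mp e1.symm
      obtain ⟨j1, j2⟩ := List.getElem?_eq_some_iff.mp hc
      have := List.pairwise_iff_getElem.mp hr c c' j1 i1 hlt
      rw [i2, j2] at this
      exact absurd this (not_le.mpr hp)
    have hcc : c = c' := by
      have h1 := aux hst g3 g3' gc gy' gc'
      have h2 := aux hst' g3' g3 gc' gy gc
      omega
    subst hcc
    have hp : p = p' := by
      have := (g3 c).symm.trans (g3' c)
      simpa using this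
    have hr : r = r' := by
      apply List.ext_getElem?
      intro i
      by_cases hi : i = c
      · rw [hi, gc, gc']
      · have := (g3 i).symm.trans (g3' i)
        simpa [hi] using this
    simp [hp, hr]

/-- The word is peeled off from its end. The set of labels can be read off the final state, and in a
sorted biword the last label is the largest, so the label needed for `rowStep_left_cancel` is known.
-/
theorem rowRun_injective {w w' : List (A × B)} (hw : w.Pairwise BiletterLE)
    (hw' : w'.Pairwise BiletterLE) (h : rowRun w = rowRun w') : w = w' := by
  induction w using List.reverseRecOn generalizing w' with
  | nil =>
    by_contra hne
    exact rowRun_fst_ne_nil (Ne.symm hne) (by rw [← h]; rfl)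
  | append_singleton w x ih =>
    rcases List.eq_nil_or_concat w' with rfl | ⟨u, x', rfl⟩
    · exact absurd (by rw [h]; rfl) (rowRun_fst_ne_nil (w := w ++ [x]) (by simp))
    simp only [List.concat_eq_append] at hw' h ⊢
    obtain ⟨a1, -, a2⟩ := List.pairwise_append.mp hw
    obtain ⟨b1, -, b2⟩ := List.pairwise_append.mp hw'
    have a3 : ∀ y ∈ w, BiletterLE y (x.1, x.2) := fun y hy => a2 y hy x (by simp)
    have b3 : ∀ y ∈ u, BiletterLE y (x'.1, x'.2) := fun y hy => b2 y hy x' (by simp)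
    have hlabels : ∀ q, q ∈ (w ++ [x]).map Prod.snd ↔ q ∈ (u ++ [x']).map Prod.snd := by
      intro q
      rw [mem_labels_rowRun (w ++ [x]), mem_labels_rowRun (u ++ [x']), h]
    have bound : ∀ {w : List (A × B)} {x : A × B}, (∀ y ∈ w, BiletterLE y (x.1, x.2)) →
        ∀ q ∈ (w ++ [x]).map Prod.snd, q ≤ x.2 := by
      intro w x hwx q hq
      obtain ⟨y, hy, rfl⟩ := List.mem_map.mp hq
      rcases List.mem_append.mp hy with hy | hy
      · exact (hwx y hy).snd_le
      · simp only [List.mem_singleton] at hy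
        rw [hy]
    have hq : x.2 = x'.2 := le_antisymm
      (bound b3 _ ((hlabels _).mp (by simp))) (bound a3 _ ((hlabels _).mpr (by simp)))
    rw [rowRun_concat, rowRun_concat] at h
    obtain ⟨h1, h2⟩ := rowStep_left_cancel (pairwise_le_rowRun w) (pairwise_le_rowRun u) hq
      (fun y hy hxy => lt_of_mem_of_bump a1 a3 hy hxy)
      (fun y hy hxy => lt_of_mem_of_bump b1 b3 hy hxy) h
    rw [ih a1 b1 h1, h2]

/-- The lower rows determine the bumped word by induction; together with the first rows it is the
full state of `rowRun`. -/
theorem insertWord_injective {w w' : List (A × B)} (hw : w.Pairwise BiletterLE)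
    (hw' : w'.Pairwise BiletterLE) (h : insertWord w = insertWord w') : w = w' := by
  induction hN : w.length using Nat.strong_induction_on generalizing w w' with
  | _ N ih =>
  subst hN
  by_cases h0 : w = []
  · by_cases h1 : w' = []
    · rw [h0, h1]
    · rw [h0, insertWord_nil, insertWord_eq_cons h1] at h
      simp at h
  · by_cases h1 : w' = []
    · rw [h1, insertWord_nil, insertWord_eq_cons h0] at h
      simp at h
    · rw [insertWord_eq_cons h0, insertWord_eq_cons h1] at h
      simp only [List.cons.injEq] at h
      have := ih _ (length_rowRun_snd_lt h0) (pairwise_rowRun_snd hw) (pairwise_rowRun_snd hw')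
        h.2 rfl
      exact rowRun_injective hw hw' (Prod.ext h.1 this)

end Biletters

/-! ### From sorted biwords to exponent matrices -/

section Tables

variable {m n : ℕ}

theorem pairwise_biword (α : Matrix (Fin m) (Fin n) ℕ) : (biword α).Pairwise BiletterLE := by
  have hlt : ∀ k, (List.finRange k).Pairwise (· < ·) := fun k => List.pairwise_lt_finRange k
  unfold biword
  rw [List.pairwise_flatMap]
  constructor
  · intro j _
    rw [List.pairwise_flatMap]
    constructor
    · intro i _
      exact List.pairwise_replicate.mpr (Or.inr (BiletterLE.refl _))
    · refine (hlt m).imp ?_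
      intro i i' hi x hx y hy
      rw [List.eq_of_mem_replicate hx, List.eq_of_mem_replicate hy]
      exact Or.inr ⟨rfl, hi.le⟩
  · refine (hlt n).imp ?_
    intro j j' hj x hx y hy
    obtain ⟨i, -, hx⟩ := List.mem_flatMap.mp hx
    obtain ⟨i', -, hy⟩ := List.mem_flatMap.mp hy
    rw [List.eq_of_mem_replicate hx, List.eq_of_mem_replicate hy]
    exact Or.inl hj

theorem biword_injective : Function.Injective (biword : Matrix (Fin m) (Fin n) ℕ → _) := by
  intro α β h
  have key : ∀ (α : Matrix (Fin m) (Fin n) ℕ) i j,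
      Multiset.count (i, j) (biword α : Multiset (Fin m × Fin n)) = α i j := by
    intro α i j
    rw [biword_coe, Multiset.count_sum', Finset.sum_eq_single j, Multiset.count_sum',
      Finset.sum_eq_single i]
    · simp
    · intro i' _ hi'
      simp [Ne.symm hi']
    · simp
    · intro j' _ hj'
      simp [Ne.symm hj']
    · simp
  ext i j
  rw [← key α, ← key β, h]

theorem rsk_injective : Function.Injective (rsk : Matrix (Fin m) (Fin n) ℕ → _) := by
  intro α β h
  unfold rsk at h
  rw [Prod.mk.injEq] at h
  have : insertWord (biword α) = insertWord (biword β) := by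
    rw [← List.zip_unzip (insertWord (biword α)), ← List.zip_unzip (insertWord (biword β)),
      List.unzip_eq_map, List.unzip_eq_map, h.1, h.2]
  exact biword_injective (insertWord_injective (pairwise_biword α) (pairwise_biword β) this)

theorem isSemistandard_rsk (α : Matrix (Fin m) (Fin n) ℕ) :
    IsSemistandard (rsk α).1 ∧ IsSemistandard (rsk α).2 ∧
      (rsk α).1.map List.length = (rsk α).2.map List.length := by
  obtain ⟨h1, h2, h3⟩ := isSemistandard_insertWord (pairwise_biword α)
  refine ⟨h1, h2, ?_⟩
  simp only [rsk, List.map_map]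
  exact List.map_congr_left h3

end Tables

end RSKOperator

namespace RSKOperator

open scoped MonomialOrder

/-! ### Leading terms of minors of a product of two generic matrices -/

section LeadingTerms

/-- The monomial with a list of variables `u` is lexicographically smaller than the one with
list `v` if the first position, in the order of variables, where they differ favours `v`. -/
theorem toLex_sum_single_lt {ι W : Type} [Fintype ι] [LinearOrder W] (u v : ι → W)
    (i₀ : ι) (h₀ : v i₀ < u i₀) (h : ∀ i, u i = v i ∨ v i₀ < u i ∧ v i₀ ≤ v i) :
    toLex (∑ i, Finsupp.single (u i) 1) < toLex (∑ i, Finsupp.single (v i) (1 : ℕ)) := by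
  have happly : ∀ (t : ι → W) w,
      (∑ i, Finsupp.single (t i) (1 : ℕ)) w = ∑ i, if t i = w then 1 else 0 := by
    intro t w
    rw [Finsupp.finsetSum_apply]
    exact Finset.sum_congr rfl fun i _ => Finsupp.single_apply
  refine ⟨v i₀, fun d hd => ?_, ?_⟩
  · simp only [ofLex_toLex, happly]
    refine Finset.sum_congr rfl fun i _ => ?_
    rcases h i with h | ⟨h1, h2⟩
    · rw [h]
    · rw [if_neg (hd.trans h1).ne', if_neg (hd.trans_le h2).ne']
  · simp only [ofLex_toLex, happly]
    refine Finset.sum_lt_sum (fun i _ => ?_) ⟨i₀, Finset.mem_univ _, ?_⟩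
    · rcases h i with h | ⟨h1, h2⟩
      · rw [h]
      · rw [if_neg h1.ne']
        exact Nat.zero_le _
    · rw [if_neg h₀.ne', if_pos rfl]
      exact Nat.one_pos

theorem monic_sum_of_unique_max {V R ι : Type} [CommRing R] [Nontrivial R] (o : MonomialOrder V)
    (s : Finset ι) (c : ι → R) (e : ι → V →₀ ℕ) {i₀ : ι} (hi₀ : i₀ ∈ s) (hc : c i₀ = 1)
    (h : ∀ i ∈ s, i ≠ i₀ → e i ≺[o] e i₀) :
    o.Monic (∑ i ∈ s, MvPolynomial.monomial (e i) (c i)) ∧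
      o.degree (∑ i ∈ s, MvPolynomial.monomial (e i) (c i)) = e i₀ := by
  classical
  have hcoeff : (∑ i ∈ s, MvPolynomial.monomial (e i) (c i)).coeff (e i₀) = 1 := by
    rw [MvPolynomial.coeff_sum, Finset.sum_eq_single i₀, MvPolynomial.coeff_monomial, if_pos rfl,
      hc]
    · intro i hi hne
      rw [MvPolynomial.coeff_monomial, if_neg]
      intro he
      have := h i hi hne
      rw [he] at this
      exact lt_irrefl _ this
    · exact fun h => absurd hi₀ h
  have hdeg : o.degree (∑ i ∈ s, MvPolynomial.monomial (e i) (c i)) = e i₀ := by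
    apply o.toSyn.injective
    apply le_antisymm
    · refine (o.degree_sum_le).trans (Finset.sup_le fun i hi => ?_)
      refine (o.degree_monomial_le _).trans ?_
      by_cases hne : i = i₀
      · rw [hne]
      · exact (h i hi hne).le
    · apply o.le_degree
      rw [MvPolynomial.mem_support_iff, hcoeff]
      exact one_ne_zero
  refine ⟨?_, hdeg⟩
  rw [MonomialOrder.Monic, MonomialOrder.leadingCoeff, hdeg, hcoeff]

/-- Variables `y k j`, and then variables `x i k` (stored as `(k, i)`), for an `m × m` matrix `x`
and an `m × n` matrix `y`. -/
abbrev FactorVar (m n : ℕ) : Type := (Fin m ×ₗ Fin n) ⊕ₗ (Fin m ×ₗ Fin m)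

variable {m n : ℕ}

/-- The variable in row `k` and column `j` of the right factor. -/
def yVar (k : Fin m) (j : Fin n) : FactorVar m n := toLex (Sum.inl (toLex (k, j)))

/-- The variable in row `i` and column `k` of the left factor. -/
def xVar (k : Fin m) (i : Fin m) : FactorVar m n := toLex (Sum.inr (toLex (k, i)))

theorem yVar_lt_yVar {k k' : Fin m} {j j' : Fin n} :
    yVar k j < yVar k' j' ↔ k < k' ∨ k = k' ∧ j < j' := by
  unfold yVar
  rw [Sum.Lex.inl_lt_inl_iff, Prod.Lex.toLex_lt_toLex]

theorem xVar_lt_xVar {k k' i i' : Fin m} :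
    (xVar k i : FactorVar m n) < xVar k' i' ↔ k < k' ∨ k = k' ∧ i < i' := by
  unfold xVar
  rw [Sum.Lex.inr_lt_inr_iff, Prod.Lex.toLex_lt_toLex]

theorem yVar_lt_xVar (k k' i : Fin m) (j : Fin n) : yVar k j < xVar k' i :=
  Sum.Lex.inl_lt_inr _ _

theorem yVar_inj {k k' : Fin m} {j j' : Fin n} : yVar k j = yVar k' j' ↔ k = k' ∧ j = j' := by
  simp [yVar]

theorem xVar_inj {k k' i i' : Fin m} :
    (xVar k i : FactorVar m n) = xVar k' i' ↔ k = k' ∧ i = i' := by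
  simp [xVar]

variable {r : ℕ}

/-- The variables of the terms of a minor of the product of the two generic factors. -/
def factorTerm (f : Fin r → Fin m) (g : Fin r → Fin n) (p : Fin r → Fin m)
    (τ : Equiv.Perm (Fin r)) : Fin r ⊕ Fin r → FactorVar m n :=
  Sum.elim (fun b => yVar (p b) (g b)) fun b => xVar (p b) (f (τ b))

/-- At the first disagreement `k`, injectivity forbids `u` to reuse the values `v a` with `a < k`,
so from there on each value of `u` is some `v a` with `k ≤ a` or exceeds all values of `v`. -/
theorem exists_first_lt {C : Type} [LinearOrder C] {u v : Fin r → C} (hu : Function.Injective u)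
    (hv : StrictMono v) (hne : u ≠ v)
    (hmem : ∀ b, (∃ a, u b = v a) ∨ ∀ a, v a < u b) :
    ∃ k, v k < u k ∧ (∀ b < k, u b = v b) ∧ ∀ b, k ≤ b → v k ≤ u b := by
  obtain ⟨k, hk, hmin⟩ : ∃ k, u k ≠ v k ∧ ∀ b < k, u b = v b := by
    have hex : ∃ k, u k ≠ v k := Function.ne_iff.mp hne
    refine ⟨wellFounded_lt.min {k | u k ≠ v k} hex, wellFounded_lt.min_mem _ hex, fun b hb => ?_⟩
    by_contra h
    exact wellFounded_lt.not_lt_min {k | u k ≠ v k} h hb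
  have hge : ∀ b, k ≤ b → v k ≤ u b := by
    intro b hb
    rcases hmem b with ⟨a, ha⟩ | h
    · rw [ha]
      apply hv.monotone
      by_contra hlt
      push Not at hlt
      have : u b = u a := by rw [ha, hmin a hlt]
      exact absurd (hu this) (hlt.trans_le hb).ne'
    · exact (h k).le
  exact ⟨k, lt_of_le_of_ne (hge k le_rfl) (Ne.symm hk), hmin, hge⟩

/-- Smaller variables weigh more, and every `y` precedes every `x`. The `y` part therefore settles
the comparison unless the middle indices are `0, 1, ..., r - 1` in order; in that case the `x` part
forces `τ = 1`. The middle index comes first in the order of both kinds of variables, so the first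
disagreement is decisive. -/
theorem factorTerm_lt {f : Fin r → Fin m} {g : Fin r → Fin n} (hf : StrictMono f)
    (hg : StrictMono g) (hr : r ≤ m) {p : Fin r → Fin m} (hp : Function.Injective p)
    {τ : Equiv.Perm (Fin r)} (h : (p, τ) ≠ (Fin.castLE hr, 1)) :
    toLex (∑ i, Finsupp.single (factorTerm f g p τ i) 1) <
      toLex (∑ i, Finsupp.single (factorTerm f g (Fin.castLE hr) 1 i) (1 : ℕ)) := by
  by_cases hp1 : p = Fin.castLE hr
  · subst hp1
    have hτ : τ ≠ 1 := fun h' => h (by rw [h'])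
    obtain ⟨k, hk, hmin, hge⟩ := exists_first_lt (u := f ∘ τ) (v := f)
      (hf.injective.comp τ.injective) hf
      (fun h' => hτ (Equiv.ext fun b => hf.injective (congrFun h' b))) (fun b => Or.inl ⟨τ b, rfl⟩)
    refine toLex_sum_single_lt _ _ (Sum.inr k) ?_ ?_
    · exact xVar_lt_xVar.mpr (Or.inr ⟨rfl, hk⟩)
    · rintro (b | b)
      · exact Or.inl rfl
      · rcases lt_trichotomy b k with hb | rfl | hb
        · left
          exact congrArg (xVar _) (hmin b hb)
        · exact Or.inr ⟨xVar_lt_xVar.mpr (Or.inr ⟨rfl, hk⟩), le_rfl⟩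
        · exact Or.inr ⟨xVar_lt_xVar.mpr (Or.inl hb), le_of_lt (xVar_lt_xVar.mpr (Or.inl hb))⟩
  · obtain ⟨k, hk, hmin, hge⟩ := exists_first_lt (u := p) (v := Fin.castLE hr)
      hp (Fin.strictMono_castLE hr) hp1 (fun b => by
        by_cases hb : (p b : ℕ) < r
        · exact Or.inl ⟨⟨p b, hb⟩, rfl⟩
        · exact Or.inr fun a => Fin.lt_def.mpr (a.2.trans_le (not_lt.mp hb)))
    refine toLex_sum_single_lt _ _ (Sum.inl k) ?_ ?_
    · exact yVar_lt_yVar.mpr (Or.inl hk)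
    · rintro (b | b)
      · rcases lt_trichotomy b k with hb | rfl | hb
        · left
          exact congrArg (fun a => yVar a (g b)) (hmin b hb)
        · exact Or.inr ⟨yVar_lt_yVar.mpr (Or.inl hk), le_rfl⟩
        · refine Or.inr ⟨yVar_lt_yVar.mpr ?_, le_of_lt (yVar_lt_yVar.mpr (Or.inl hb))⟩
          rcases lt_or_eq_of_le (hge b hb.le) with h1 | h1
          · exact Or.inl h1
          · exact Or.inr ⟨h1, hg hb⟩
      · exact Or.inr ⟨yVar_lt_xVar _ _ _ _, (yVar_lt_xVar _ _ _ _).le⟩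

variable (R : Type) [CommRing R]

/-- Expanding each entry of the product yields a sum over all functions `p` of middle indices. For a
non-injective `p` the sum over `τ` is a multiple of a determinant with two equal columns and
vanishes. -/
theorem det_factor_eq_sum (f : Fin r → Fin m) (g : Fin r → Fin n) :
    Matrix.det (Matrix.of fun a b : Fin r => ∑ k : Fin m,
      (MvPolynomial.X (xVar k (f a)) * MvPolynomial.X (yVar k (g b)) :
        MvPolynomial (FactorVar m n) R)) =
    ∑ i ∈ {i : (Fin r → Fin m) × Equiv.Perm (Fin r) | Function.Injective i.1},
      MvPolynomial.monomial (∑ v, Finsupp.single (factorTerm f g i.1 i.2 v) 1)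
        ((Equiv.Perm.sign i.2 : ℤ) : R) := by
  have hterm : ∀ i : (Fin r → Fin m) × Equiv.Perm (Fin r),
      MvPolynomial.monomial (∑ v, Finsupp.single (factorTerm f g i.1 i.2 v) 1)
        ((Equiv.Perm.sign i.2 : ℤ) : R) =
      ((Equiv.Perm.sign i.2 : ℤ) : MvPolynomial (FactorVar m n) R) *
        ∏ b, (MvPolynomial.X (xVar (i.1 b) (f (i.2 b))) * MvPolynomial.X (yVar (i.1 b) (g b))) := by
    intro i
    rw [← mul_one ((Equiv.Perm.sign i.2 : ℤ) : R), ← MvPolynomial.C_mul_monomial,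
      MvPolynomial.monomial_sum_one, Fintype.prod_sum_type, Finset.prod_mul_distrib, mul_comm
      (∏ b, MvPolynomial.X (xVar (i.1 b) (f (i.2 b))))]
    simp [factorTerm, MvPolynomial.X]
  rw [Finset.sum_filter, ← Finset.univ_product_univ, Finset.sum_product]
  have hinner : ∀ p : Fin r → Fin m, (∑ τ : Equiv.Perm (Fin r),
      if Function.Injective p then MvPolynomial.monomial
        (∑ v, Finsupp.single (factorTerm f g p τ v) 1) ((Equiv.Perm.sign τ : ℤ) : R) else 0) =
      ∑ τ : Equiv.Perm (Fin r), ((Equiv.Perm.sign τ : ℤ) : MvPolynomial (FactorVar m n) R) *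
        ∏ b, (MvPolynomial.X (xVar (p b) (f (τ b))) * MvPolynomial.X (yVar (p b) (g b))) := by
    intro p
    by_cases hp : Function.Injective p
    · refine Finset.sum_congr rfl fun τ _ => ?_
      rw [if_pos hp]
      exact hterm (p, τ)
    · simp only [if_neg hp, Finset.sum_const_zero]
      have hdet : Matrix.det (Matrix.of fun a b : Fin r =>
          (MvPolynomial.X (xVar (p b) (f a)) : MvPolynomial (FactorVar m n) R)) = 0 := by
        obtain ⟨b, b', hbb, hne⟩ : ∃ b b', p b = p b' ∧ b ≠ b' := by
          simpa [Function.Injective] using hp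
        exact Matrix.det_zero_of_column_eq hne fun a => by simp [hbb]
      rw [Matrix.det_apply'] at hdet
      have := congrArg (· * ∏ b, (MvPolynomial.X (yVar (p b) (g b)) :
        MvPolynomial (FactorVar m n) R)) hdet
      simp only [zero_mul, Finset.sum_mul] at this
      rw [← this]
      refine Finset.sum_congr rfl fun τ _ => ?_
      rw [Finset.prod_mul_distrib, mul_assoc]
      rfl
  refine Eq.trans ?_ (Finset.sum_congr rfl fun p _ => (hinner p).symm)
  rw [Matrix.det_apply', Finset.sum_comm]
  refine Finset.sum_congr rfl fun τ _ => ?_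
  simp only [Matrix.of_apply]
  rw [Finset.prod_univ_sum, Fintype.piFinset_univ, Finset.mul_sum]

theorem leading_det_factor [Nontrivial R] {f : Fin r → Fin m} {g : Fin r → Fin n}
    (hf : StrictMono f) (hg : StrictMono g) (hr : r ≤ m) {D : MvPolynomial (FactorVar m n) R}
    (hD : D = Matrix.det (Matrix.of fun a b : Fin r => ∑ k : Fin m,
      (MvPolynomial.X (xVar k (f a)) * MvPolynomial.X (yVar k (g b))))) :
    MonomialOrder.lex.Monic D ∧ MonomialOrder.lex.degree D =
      ∑ v, Finsupp.single (factorTerm f g (Fin.castLE hr) 1 v) 1 := by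
  rw [hD, det_factor_eq_sum]
  refine monic_sum_of_unique_max MonomialOrder.lex _
    (fun i : (Fin r → Fin m) × Equiv.Perm (Fin r) => ((Equiv.Perm.sign i.2 : ℤ) : R))
    (fun i => ∑ v, Finsupp.single (factorTerm f g i.1 i.2 v) 1)
    (i₀ := (Fin.castLE hr, 1)) ?_ (by simp) ?_
  · simpa using Fin.castLE_injective hr
  · intro i hi hne
    rw [MonomialOrder.lex_lt_iff]
    exact factorTerm_lt hf hg hr (by simpa using hi) hne

/-- The minor over an arbitrary commutative ring. -/
noncomputable def ringMinor (I : List (Fin m)) (J : List (Fin n)) :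
    MvPolynomial (Fin m × Fin n) R :=
  if h : I.length = J.length then
    Matrix.det (Matrix.of fun a b : Fin I.length =>
      (MvPolynomial.X (I.get a, J.get (Fin.cast h b)) : MvPolynomial (Fin m × Fin n) R))
  else 0

/-- The bitableau over an arbitrary commutative ring. -/
noncomputable def ringBitableau (P : Tableau (Fin m)) (Q : Tableau (Fin n)) :
    MvPolynomial (Fin m × Fin n) R :=
  ∏ c ∈ Finset.range (max (numColumns P) (numColumns Q)), ringMinor R (column c P) (column c Q)

theorem ringBitableau_complex (P : Tableau (Fin m)) (Q : Tableau (Fin n)) :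
    ringBitableau ℂ P Q = bitableau P Q := rfl

theorem map_ringBitableau {R S : Type} [CommRing R] [CommRing S] (φ : R →+* S)
    (P : Tableau (Fin m)) (Q : Tableau (Fin n)) :
    MvPolynomial.map φ (ringBitableau R P Q) = ringBitableau S P Q := by
  unfold ringBitableau
  rw [map_prod]
  refine Finset.prod_congr rfl fun c _ => ?_
  unfold ringMinor
  split_ifs with h
  · rw [RingHom.map_det]
    congr 1
    ext1 a b
    simp
  · exact map_zero _

/-- The substitution of the product of an `m × m` and an `m × n` generic matrix. -/
noncomputable def factorSubst (m n : ℕ) :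
    MvPolynomial (Fin m × Fin n) R →ₐ[R] MvPolynomial (FactorVar m n) R :=
  MvPolynomial.aeval fun ij => ∑ k : Fin m,
    MvPolynomial.X (xVar k ij.1) * MvPolynomial.X (yVar k ij.2)

theorem sum_ite_get {C : Type} [DecidableEq C] (l : List C) {r : ℕ} (h : r = l.length)
    (k : ℕ) (z : C) :
    (∑ a : Fin r, if (a : ℕ) = k ∧ l.get (Fin.cast h a) = z then 1 else 0) =
      if l[k]? = some z then 1 else 0 := by
  subst h
  by_cases hk : k < l.length
  · rw [Finset.sum_eq_single ⟨k, hk⟩]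
    · simp [hk]
    · intro a _ ha
      rw [if_neg]
      rintro ⟨rfl, _⟩
      exact ha rfl
    · simp
  · rw [List.getElem?_eq_none (not_lt.mp hk), if_neg (by simp)]
    refine Finset.sum_eq_zero fun a _ => if_neg ?_
    rintro ⟨rfl, _⟩
    exact hk a.2

theorem leading_ringMinor [Nontrivial R] {I : List (Fin m)} {J : List (Fin n)}
    (hI : I.Pairwise (· < ·)) (hJ : J.Pairwise (· < ·)) (h : I.length = J.length) :
    MonomialOrder.lex.Monic (factorSubst R m n (ringMinor R I J)) ∧
    (∀ k j, MonomialOrder.lex.degree (factorSubst R m n (ringMinor R I J)) (yVar k j) =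
      if J[(k : ℕ)]? = some j then 1 else 0) ∧
    ∀ k i, MonomialOrder.lex.degree (factorSubst R m n (ringMinor R I J)) (xVar k i) =
      if I[(k : ℕ)]? = some i then 1 else 0 := by
  -- A strictly increasing list in `Fin m` has at most `m` entries, so `m` middle indices are enough
  -- for the leading term to exist.
  have hr : I.length ≤ m := by
    have := List.Nodup.length_le_card (hI.imp fun h => ne_of_lt h)
    simpa using this
  have hD : factorSubst R m n (ringMinor R I J) =
      Matrix.det (Matrix.of fun a b : Fin I.length => ∑ k : Fin m,
        (MvPolynomial.X (xVar k (I.get a)) * MvPolynomial.X (yVar k (J.get (Fin.cast h b))) :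
          MvPolynomial (FactorVar m n) R)) := by
    rw [ringMinor, dif_pos h, AlgHom.map_det]
    congr 1
    ext1 a b
    simp [factorSubst]
  obtain ⟨h1, h2⟩ := leading_det_factor R (f := I.get) (g := fun b => J.get (Fin.cast h b))
    (fun a b hab => List.pairwise_iff_get.mp hI a b hab)
    (fun a b hab => List.pairwise_iff_get.mp hJ _ _ hab) hr hD
  refine ⟨h1, fun k j => ?_, fun k i => ?_⟩
  · rw [h2, Finsupp.finsetSum_apply, Fintype.sum_sum_type, ← sum_ite_get J h]
    have : ∀ a, (Finsupp.single (factorTerm I.get (fun b => J.get (Fin.cast h b)) (Fin.castLE hr)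
        1 (Sum.inr a)) 1 : FactorVar m n →₀ ℕ) (yVar k j) = 0 := fun a =>
      Finsupp.single_eq_of_ne (yVar_lt_xVar _ _ _ _).ne
    simp only [this, Finset.sum_const_zero, add_zero]
    refine Finset.sum_congr rfl fun a _ => ?_
    rw [Finsupp.single_apply]
    simp only [factorTerm, Sum.elim_inl, yVar_inj, Fin.ext_iff, Fin.val_castLE]
  · rw [h2, Finsupp.finsetSum_apply, Fintype.sum_sum_type, ← sum_ite_get I rfl]
    have : ∀ a, (Finsupp.single (factorTerm I.get (fun b => J.get (Fin.cast h b)) (Fin.castLE hr)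
        1 (Sum.inl a)) 1 : FactorVar m n →₀ ℕ) (xVar k i) = 0 := fun a =>
      Finsupp.single_eq_of_ne (yVar_lt_xVar _ _ _ _).ne'
    simp only [this, Finset.sum_const_zero, zero_add]
    refine Finset.sum_congr rfl fun a _ => ?_
    rw [Finsupp.single_apply]
    simp only [factorTerm, Sum.elim_inr, xVar_inj, Fin.ext_iff, Fin.val_castLE,
      Equiv.Perm.coe_one, id_eq]
    rfl

end LeadingTerms

/-! ### Columns and rows of semistandard tableaux -/

section Columns

/-- `column` skips rows that are too short. Row lengths decrease weakly, so only rows at the bottom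
are skipped and the `k`-th entry of a column does come from row `k`. -/
theorem column_getElem? {C : Type} [LinearOrder C] {T : Tableau C}
    (hT : T.Pairwise ColumnStrict) (c k : ℕ) : (column c T)[k]? = (T.getD k [])[c]? := by
  induction T generalizing k with
  | nil => simp [column]
  | cons r T ih =>
    have hT' := (List.pairwise_cons.mp hT)
    unfold column at ih ⊢
    rw [List.filterMap_cons]
    cases hr : r[c]? with
    | none =>
      have hnone : ∀ t ∈ T, t[c]? = none := by
        intro t ht
        rw [List.getElem?_eq_none_iff] at hr ⊢
        exact (hT'.1 t ht).length_le.trans hr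
      have hnil : T.filterMap (fun r => r[c]?) = [] := by
        rw [List.filterMap_eq_nil_iff]
        exact hnone
      rw [hnil]
      cases k with
      | zero => simp [hr]
      | succ k =>
        simp only [List.getElem?_nil, List.getD_cons_succ]
        by_cases hk : k < T.length
        · rw [List.getD_eq_getElem _ _ hk, hnone _ (List.getElem_mem hk)]
        · rw [List.getD_eq_default _ _ (not_lt.mp hk)]
          simp
    | some x =>
      cases k with
      | zero => simp [hr]
      | succ k => simpa using ih hT'.2 k

theorem pairwise_lt_column {C : Type} [LinearOrder C] {T : Tableau C}
    (hT : T.Pairwise ColumnStrict) (c : ℕ) : (column c T).Pairwise (· < ·) := by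
  unfold column
  rw [List.pairwise_filterMap]
  refine hT.imp ?_
  intro r r' h x hx y hy
  obtain ⟨z, hz, hzy⟩ := h c y hy
  rw [hx] at hz
  exact (Option.some.inj hz) ▸ hzy

theorem length_column_eq {C D : Type} {T : Tableau C} {U : Tableau D}
    (h : T.map List.length = U.map List.length) (c : ℕ) :
    (column c T).length = (column c U).length := by
  induction T generalizing U with
  | nil =>
    have : U = [] := by simpa [eq_comm] using h
    simp [this, column]
  | cons r T ih =>
    cases U with
    | nil => simp at h
    | cons s U =>
      simp only [List.map_cons, List.cons.injEq] at h
      have hlen := ih h.2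
      unfold column at hlen ⊢
      by_cases hc : c < r.length
      · have hc' : c < s.length := h.1 ▸ hc
        simp [hc, hc', hlen]
      · have hc' : ¬ c < s.length := h.1 ▸ hc
        simp only [List.filterMap_cons, List.getElem?_eq_none (not_lt.mp hc),
          List.getElem?_eq_none (not_lt.mp hc'), hlen]

theorem sum_ite_getElem? {C : Type} [DecidableEq C] (l : List C) (z : C) {N : ℕ}
    (h : l.length ≤ N) :
    (∑ c ∈ Finset.range N, if l[c]? = some z then 1 else 0) = l.count z := by
  induction l generalizing N with
  | nil => simp
  | cons x l ih =>
    obtain ⟨k, rfl⟩ : ∃ k, N = k + 1 := ⟨N - 1, by simp at h; omega⟩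
    rw [Finset.sum_range_succ', List.count_cons, ← ih (by simpa using h)]
    simp

theorem length_getD_le_numColumns {C : Type} (T : Tableau C) (k : ℕ) :
    (T.getD k []).length ≤ numColumns T := by
  induction T generalizing k with
  | nil => simp
  | cons r T ih =>
    have h : numColumns (r :: T) = max r.length (numColumns T) := rfl
    rw [h]
    cases k with
    | zero => simp
    | succ k =>
      rw [List.getD_cons_succ]
      exact (ih k).trans (le_max_right _ _)

/-- The first column meets every row, since no row is empty, and it increases strictly in `Fin m`.
-/
theorem IsSemistandard.length_le {m : ℕ} {T : Tableau (Fin m)} (hT : IsSemistandard T) :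
    T.length ≤ m := by
  have h0 : (RSKOperator.column 0 T).length = T.length := by
    unfold RSKOperator.column
    have : ∀ U : Tableau (Fin m), (∀ r ∈ U, r ≠ []) →
        (U.filterMap fun r => r[0]?).length = U.length := by
      intro U hU
      induction U with
      | nil => rfl
      | cons r U ih =>
        simp only [List.mem_cons, forall_eq_or_imp] at hU
        obtain ⟨x, r, rfl⟩ := List.exists_cons_of_ne_nil hU.1
        simp [ih hU.2]
    exact this T hT.ne_nil
  rw [← h0]
  have := List.Nodup.length_le_card ((pairwise_lt_column hT.column 0).imp fun h => ne_of_lt h)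
  simpa using this

/-- A sorted row is determined by its multiplicities. The default `[]` marks the end of the tableau
because actual rows are nonempty, so the number of rows is determined as well. -/
theorem IsSemistandard.ext_count {C : Type} [LinearOrder C] {T U : Tableau C}
    (hT : IsSemistandard T) (hU : IsSemistandard U)
    (h : ∀ (k : ℕ) z, (T.getD k []).count z = (U.getD k []).count z) : T = U := by
  have hrow : ∀ {T : Tableau C}, IsSemistandard T → ∀ k, (T.getD k []).Pairwise (· ≤ ·) := by
    intro T hT k
    by_cases hk : k < T.length
    · rw [List.getD_eq_getElem _ _ hk]
      exact hT.row _ (List.getElem_mem hk)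
    · rw [List.getD_eq_default _ _ (not_lt.mp hk)]
      exact List.Pairwise.nil
  have heq : ∀ k, T.getD k [] = U.getD k [] := fun k =>
    (List.perm_iff_count.mpr (h k)).eq_of_pairwise
      (fun a b _ _ h1 h2 => le_antisymm h1 h2) (hrow hT k) (hrow hU k)
  have hlen : ∀ {T U : Tableau C}, IsSemistandard T → (∀ k, T.getD k [] = U.getD k []) →
      T.length ≤ U.length := by
    intro T U hT h
    by_contra hlt
    push Not at hlt
    have h1 := h U.length
    rw [List.getD_eq_getElem _ _ hlt, List.getD_eq_default _ _ le_rfl] at h1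
    exact hT.ne_nil _ (List.getElem_mem hlt) h1
  have hl := le_antisymm (hlen hT heq) (hlen hU fun k => (heq k).symm)
  refine List.ext_getElem hl fun k h1 h2 => ?_
  rw [← List.getD_eq_getElem _ [] h1, ← List.getD_eq_getElem _ [] h2, heq]

end Columns

/-! ### Linear independence of the RSK bitableaux over any domain -/

section Independence

/-- In a nontrivial relation, the largest leading monomial among the terms with nonzero coefficient
occurs only once, and nothing cancels it. -/
theorem linearIndependent_of_monic_of_degree_injective {F V ι : Type} [CommRing F] (o : MonomialOrder V)
    (g : ι → MvPolynomial V F) (hg : ∀ i, o.Monic (g i))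
    (hinj : Function.Injective fun i => o.degree (g i)) : LinearIndependent F g := by
  rw [linearIndependent_iff']
  intro s v hv
  by_contra hne
  push Not at hne
  obtain ⟨i₁, hi₁, hv₁⟩ := hne
  classical
  obtain ⟨i, hi, hmax⟩ := (s.filter fun i => v i ≠ 0).exists_max_image
    (fun i => o.toSyn (o.degree (g i))) ⟨i₁, by simp [hi₁, hv₁]⟩
  rw [Finset.mem_filter] at hi
  have hcoeff := congrArg (MvPolynomial.coeff (o.degree (g i))) hv
  rw [MvPolynomial.coeff_sum, Finset.sum_eq_single i, MvPolynomial.coeff_smul,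
    (hg i).coeff_degree, MvPolynomial.coeff_zero, smul_eq_mul, mul_one] at hcoeff
  · exact hi.2 hcoeff
  · intro j hj hji
    by_cases hvj : v j = 0
    · rw [hvj, zero_smul, MvPolynomial.coeff_zero]
    · rw [MvPolynomial.coeff_smul, o.coeff_eq_zero_of_lt, smul_zero]
      refine lt_of_le_of_ne (hmax j (by simp [hj, hvj])) fun h => hji ?_
      exact hinj (o.toSyn.injective h)
  · exact fun h => absurd hi.1 h

variable {m n : ℕ} (F : Type) [CommRing F] [IsDomain F]

/-- Degrees of the factors add up over the columns `c`. For fixed `k`, summing over `c` the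
indicator that row `k` has a given entry in column `c` counts that entry in row `k`. -/
theorem leading_ringBitableau {P : Tableau (Fin m)} {Q : Tableau (Fin n)} (hP : IsSemistandard P)
    (hQ : IsSemistandard Q) (h : P.map List.length = Q.map List.length) :
    MonomialOrder.lex.Monic (factorSubst F m n (ringBitableau F P Q)) ∧
    (∀ (k : Fin m) j, MonomialOrder.lex.degree (factorSubst F m n (ringBitableau F P Q)) (yVar k j)
      = (Q.getD k []).count j) ∧
    ∀ (k : Fin m) i, MonomialOrder.lex.degree (factorSubst F m n (ringBitableau F P Q)) (xVar k i)
      = (P.getD k []).count i := by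
  have hc := fun c => leading_ringMinor F (pairwise_lt_column hP.column c)
    (pairwise_lt_column hQ.column c) (length_column_eq h c)
  unfold ringBitableau
  rw [map_prod, MonomialOrder.degree_prod fun c _ => (hc c).1.ne_zero]
  refine ⟨MonomialOrder.Monic.prod fun c _ => (hc c).1, fun k j => ?_, fun k i => ?_⟩
  · rw [Finsupp.finsetSum_apply]
    simp only [(hc _).2.1, column_getElem? hQ.column]
    exact sum_ite_getElem? _ _ ((length_getD_le_numColumns Q k).trans (le_max_right _ _))
  · rw [Finsupp.finsetSum_apply]
    simp only [(hc _).2.2, column_getElem? hP.column]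
    exact sum_ite_getElem? _ _ ((length_getD_le_numColumns P k).trans (le_max_left _ _))

theorem linearIndependent_ringBitableau_rsk :
    LinearIndependent F fun α : Matrix (Fin m) (Fin n) ℕ =>
      ringBitableau F (rsk α).1 (rsk α).2 := by
  have hlead := fun α : Matrix (Fin m) (Fin n) ℕ =>
    leading_ringBitableau F (isSemistandard_rsk α).1 (isSemistandard_rsk α).2.1
      (isSemistandard_rsk α).2.2
  have hlen := fun α : Matrix (Fin m) (Fin n) ℕ => (isSemistandard_rsk α).1.length_le
  -- The leading exponents see only rows with index below `m`. For `Q` this bound comes from the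
  -- common shape, as its entries alone would give only `n`.
  have hlen' : ∀ α : Matrix (Fin m) (Fin n) ℕ, (rsk α).2.length ≤ m := by
    intro α
    have := congrArg List.length (isSemistandard_rsk α).2.2
    simp only [List.length_map] at this
    exact this ▸ hlen α
  -- Independence of the images suffices, so injectivity of the substitution plays no role.
  refine LinearIndependent.of_comp (factorSubst F m n).toLinearMap ?_
  refine linearIndependent_of_monic_of_degree_injective MonomialOrder.lex _
    (fun α => (hlead α).1) ?_
  intro α β h
  simp only [Function.comp_apply, AlgHom.toLinearMap_apply] at h
  have count_eq : ∀ {C : Type} [LinearOrder C] {T U : Tableau C}, T.length ≤ m → U.length ≤ m →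
      (∀ (k : Fin m) z, (T.getD k []).count z = (U.getD k []).count z) →
      ∀ (k : ℕ) z, (T.getD k []).count z = (U.getD k []).count z := by
    intro C _ T U hT hU h k z
    by_cases hk : k < m
    · exact h ⟨k, hk⟩ z
    · rw [List.getD_eq_default _ _ (hT.trans (not_lt.mp hk)),
        List.getD_eq_default _ _ (hU.trans (not_lt.mp hk))]
  apply rsk_injective
  refine Prod.ext ?_ ?_
  · refine (isSemistandard_rsk α).1.ext_count (isSemistandard_rsk β).1
      (count_eq (hlen α) (hlen β) fun k z => ?_)
    rw [← (hlead α).2.2, ← (hlead β).2.2, h]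
  · refine (isSemistandard_rsk α).2.1.ext_count (isSemistandard_rsk β).2.1
      (count_eq (hlen' α) (hlen' β) fun k z => ?_)
    rw [← (hlead α).2.1, ← (hlead β).2.1, h]

end Independence

end RSKOperator

namespace RSKOperator

/-! ### Unimodularity by reduction modulo every prime -/

section Determinant

variable {m n : ℕ} {ι : Type} [Fintype ι] [DecidableEq ι]

theorem exponent_injective : Function.Injective (exponent : Matrix (Fin m) (Fin n) ℕ → _) := by
  intro α β h
  ext i j
  exact DFunLike.congr_fun h (i, j)

theorem coeff_eq_zero_of_mem_span {κ : Type} {e : κ → Matrix (Fin m) (Fin n) ℕ}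
    {f : CoordRing m n} (hf : f ∈ Submodule.span ℂ (Set.range fun a => zMonomial (e a)))
    {d : Fin m × Fin n →₀ ℕ} (hd : ∀ a, exponent (e a) ≠ d) : f.coeff d = 0 := by
  refine Submodule.span_induction ?_ ?_ ?_ ?_ hf
  · rintro _ ⟨a, rfl⟩
    classical
    change (zMonomial (e a)).coeff d = 0
    rw [zMonomial, MvPolynomial.coeff_monomial, if_neg (hd a)]
  · exact MvPolynomial.coeff_zero d
  · intro x y _ _ hx hy
    rw [MvPolynomial.coeff_add, hx, hy, add_zero]
  · intro c x _ hx
    rw [MvPolynomial.coeff_smul, hx, smul_zero]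

/-- The integer matrix of the operator on the monomials with exponents in the family `e`. -/
noncomputable def integerMatrix (e : ι → Matrix (Fin m) (Fin n) ℕ) : Matrix ι ι ℤ :=
  Matrix.of fun b a => (ringBitableau ℤ (rsk (e a)).1 (rsk (e a)).2).coeff (exponent (e b))

/-- If a prime `p` divided the determinant, a kernel vector modulo `p` would be a linear relation
between bitableaux over `ZMod p`. The hypothesis `hspan` ensures that the matrix records all their
coefficients. -/
theorem isUnit_det_integerMatrix {e : ι → Matrix (Fin m) (Fin n) ℕ} (he : Function.Injective e)
    (hspan : ∀ a, bitableau (rsk (e a)).1 (rsk (e a)).2 ∈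
      Submodule.span ℂ (Set.range fun a => zMonomial (e a))) :
    IsUnit (integerMatrix e).det := by
  rw [Int.isUnit_iff_natAbs_eq]
  by_contra hne
  obtain ⟨p, hp, hdvd⟩ := Nat.exists_prime_and_dvd hne
  have : Fact p.Prime := ⟨hp⟩
  have hdet : ((integerMatrix e).map (Int.castRingHom (ZMod p))).det = 0 := by
    rw [← RingHom.mapMatrix_apply, ← RingHom.map_det, eq_intCast,
      ZMod.intCast_zmod_eq_zero_iff_dvd]
    exact Int.natCast_dvd.mpr hdvd
  obtain ⟨v, hv, hmul⟩ := Matrix.exists_mulVec_eq_zero_iff.mpr hdet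
  have hli := (linearIndependent_ringBitableau_rsk (m := m) (n := n) (ZMod p)).comp e he
  rw [Fintype.linearIndependent_iff] at hli
  refine hv (funext (hli v ?_))
  have hcoeff : ∀ a d, (ringBitableau (ZMod p) (rsk (e a)).1 (rsk (e a)).2).coeff d =
      (((ringBitableau ℤ (rsk (e a)).1 (rsk (e a)).2).coeff d : ℤ) : ZMod p) := by
    intro a d
    rw [← map_ringBitableau (Int.castRingHom (ZMod p)), MvPolynomial.coeff_map, eq_intCast]
  ext d
  rw [MvPolynomial.coeff_sum, MvPolynomial.coeff_zero]
  by_cases hd : ∃ b, exponent (e b) = d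
  · obtain ⟨b, rfl⟩ := hd
    have := congrFun hmul b
    rw [Pi.zero_apply] at this
    rw [← this, Matrix.mulVec, dotProduct]
    refine Finset.sum_congr rfl fun a _ => ?_
    rw [MvPolynomial.coeff_smul, Function.comp_apply, hcoeff, smul_eq_mul, mul_comm]
    rfl
  · push Not at hd
    refine Finset.sum_eq_zero fun a _ => ?_
    -- Outside the family the coefficient vanishes over `ℂ`, hence over `ℤ` because `ℤ` embeds in
    -- `ℂ`, and hence modulo `p`.
    have h0 := coeff_eq_zero_of_mem_span (hspan a) hd
    rw [← ringBitableau_complex, ← map_ringBitableau (Int.castRingHom ℂ), MvPolynomial.coeff_map,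
      eq_intCast, Int.cast_eq_zero] at h0
    rw [MvPolynomial.coeff_smul, Function.comp_apply, hcoeff, h0, Int.cast_zero, smul_zero]

/-- The determinant of the restriction of the operator to an invariant space of monomials. -/
theorem det_toMatrix_operator_mem {e : ι → Matrix (Fin m) (Fin n) ℕ} (he : Function.Injective e)
    {W : Submodule ℂ (CoordRing m n)}
    (hW : W = Submodule.span ℂ (Set.range fun a => zMonomial (e a)))
    (b : Module.Basis ι ℂ W) (hb : ∀ a, (b a : CoordRing m n) = zMonomial (e a))
    (f : W →ₗ[ℂ] W) (hf : ∀ x, (f x : CoordRing m n) = operator m n x) :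
    (LinearMap.toMatrix b b f).det ∈ ({1, -1} : Set ℂ) := by
  have hop : ∀ a, (f (b a) : CoordRing m n) = bitableau (rsk (e a)).1 (rsk (e a)).2 := fun a => by
    rw [hf, hb, operator_zMonomial]
  have hrepr : ∀ (x : W) a, b.repr x a = (x : CoordRing m n).coeff (exponent (e a)) := by
    intro x a
    have h1 := congrArg (fun y : W => (y : CoordRing m n).coeff (exponent (e a)))
      (b.sum_repr x)
    rw [← h1]
    simp only [Submodule.coe_sum, Submodule.coe_smul, hb, MvPolynomial.coeff_sum,
      MvPolynomial.coeff_smul]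
    rw [Finset.sum_eq_single a]
    · simp [zMonomial]
    · intro c _ hc
      rw [zMonomial, MvPolynomial.coeff_monomial,
        if_neg fun h => hc (he (exponent_injective h)), smul_zero]
    · simp
  have hM : LinearMap.toMatrix b b f = (integerMatrix e).map (Int.castRingHom ℂ) := by
    ext c a
    rw [LinearMap.toMatrix_apply, hrepr, hop, ← ringBitableau_complex,
      ← map_ringBitableau (Int.castRingHom ℂ), MvPolynomial.coeff_map]
    rfl
  rw [hM, ← RingHom.mapMatrix_apply, ← RingHom.map_det]
  have hunit := isUnit_det_integerMatrix he fun a => by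
    rw [← hW, ← hop]
    exact (f (b a)).2
  rcases Int.isUnit_iff.mp hunit with h | h <;> simp [h]

end Determinant

end RSKOperator

theorem proposition2p5 (m n : ℕ) :
    (∀ d : ℕ, (RSKOperator.degreeMatrix m n d).det ∈ ({1, -1} : Set ℂ)) ∧
    (∀ (σ : Fin m → ℕ) (π : Fin n → ℕ), ∑ i, σ i = ∑ j, π j →
      (RSKOperator.weightMatrix σ π).det ∈ ({1, -1} : Set ℂ)) := by
  constructor
  · intro d
    exact RSKOperator.det_toMatrix_operator_mem Subtype.val_injective rfl
      (RSKOperator.degreeBasis m n d)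
      (fun a => by rw [RSKOperator.degreeBasis, Module.Basis.span_apply]) _ fun x => rfl
  · intro σ π _
    exact RSKOperator.det_toMatrix_operator_mem Subtype.val_injective rfl
      (RSKOperator.weightBasis σ π)
      (fun a => by rw [RSKOperator.weightBasis, Module.Basis.span_apply]) _ fun x => rfl
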